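/- Equip $\mathbb C^2$, with coordinates $(z,w)$, $z=x_1+iy_1$, $w=x_2+iy_2$, with the standard symplectic form $\omega=dx_1\wedge dy_1+dx_2\wedge dy_2$, and let $B(3)=\{\pi(|z|^2+|w|^2)<3\}$ and $P(2,2)=\{\pi|z|^2<2,\ \pi|w|^2<2\}$. For a Lagrangian torus $L\subset\mathbb C^2$ let $\Omega:H_1(L;\mathbb Z)\to\mathbb R$ be the area class (the integral of a primitive of $\omega$ over loops) and $\mu:H_1(L;\mathbb Z)\to\mathbb Z$ the Maslov class. Let $x>2$ and let $\mathcal U$ be any neighbourhood of the closure $\overline{B(3)\cap P(2,2)}$. Then there exist a smoothly embedded Lagrangian torus $L\subset\mathcal U$, an integral basis $(e_1,e_2)$ of $H_1(L;\mathbb Z)$, a smoothly embedded solid torus $\Sigma\cong S^1\times D^2$ in $\mathbb C^2$ with $\partial\Sigma=L$, and $a,b\in\mathbb C$ such that: 1. $\mu(e_1)=\mu(e_2)=2$, $\Omega(e_1)=x$ and $\Omega(e_2)=1$; 2. the meridian discs $\{\theta\}\times D^2$ of $\Sigma$ are symplectic, and their boundaries (with the orientation induced by $\omega$) lie in the class $e_2$;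 3. every leaf of the characteristic foliation $\ker(\omega|_{T\Sigma})$ of $\Sigma$ is closed; 4. $\Sigma$ (and hence $L$) is disjoint from the complex lines $\{z=a\}$ and $\{w=b\}$; 5. $\operatorname{lk}(e_2,\{z=a\})=\operatorname{lk}(e_2,\{w=b\})=0$; 6. $\operatorname{lk}(e_1,\{z=a\})=1$ and $\operatorname{lk}(e_1,\{w=b\})=-1$. Here the linking number of a loop with $\{z=a\}$ (respectively $\{w=b\}$) is the winding number of $z-a$ (respectively $w-b$) along the loop. -/

import Mathlib

open scoped ContDiff Topology
open Set

noncomputable section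

namespace LagTorus

/-- The space `ℂ²` with coordinates `(z, w)`. -/
abbrev C2 : Type := ℂ × ℂ

/-- The standard symplectic form `dx₁ ∧ dy₁ + dx₂ ∧ dy₂` on `ℂ²`. -/
def omega (u v : C2) : ℝ :=
  (u.1.re * v.1.im - u.1.im * v.1.re) + (u.2.re * v.2.im - u.2.im * v.2.re)

/-- The open ball of capacity `R`. -/
def ballCap (R : ℝ) : Set C2 :=
  {p | Real.pi * (‖p.1‖ ^ 2 + ‖p.2‖ ^ 2) < R}

/-- The open polydisc with factors of areas `a` and `b`. -/
def polydisc (a b : ℝ) : Set C2 :=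
  {p | Real.pi * ‖p.1‖ ^ 2 < a ∧ Real.pi * ‖p.2‖ ^ 2 < b}

/-- `F : ℝ² → ℂ²` induces a smooth embedding of the torus `ℝ²/ℤ²`
(an injective immersion of a compact manifold). -/
structure IsEmbeddedTorus (F : ℝ × ℝ → C2) : Prop where
  smooth : ContDiff ℝ ∞ F
  eq_iff : ∀ p q : ℝ × ℝ, F p = F q ↔ ∃ k l : ℤ, q = p + ((k : ℝ), (l : ℝ))
  immersion : ∀ p : ℝ × ℝ, Function.Injective (fderiv ℝ F p)

/-- The map `F` is isotropic: the form `omega` vanishes on its tangent planes. -/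
def IsLagrangian (F : ℝ × ℝ → C2) : Prop :=
  ∀ p u v : ℝ × ℝ, omega (fderiv ℝ F p u) (fderiv ℝ F p v) = 0

/-- `γ` is the lift to `ℝ²` of a smooth loop `ℝ/ℤ → ℝ²/ℤ²` whose class in
`H₁(ℝ²/ℤ²; ℤ) = ℤ²` is `e`. For an embedded torus `F`, the loop `F ∘ γ` then represents the
class `e` of `H₁(L; ℤ)`, where `L` is the image of `F`; every smooth loop in `L` is of this
form, and `H₁(L; ℤ)` is identified with the period lattice `ℤ²` in this way. -/
def IsLoopOfClass (γ : ℝ → ℝ × ℝ) (e : ℤ × ℤ) : Prop :=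
  ContDiff ℝ ∞ γ ∧ ∀ t : ℝ, γ (t + 1) = γ t + ((e.1 : ℝ), (e.2 : ℝ))

/-- The integral of the Liouville form `½ ∑ (xᵢ dyᵢ - yᵢ dxᵢ)`, a primitive of `omega`, along
the loop `c : ℝ/ℤ → ℂ²`. -/
def liouvilleIntegral (c : ℝ → C2) : ℝ :=
  ∫ t in (0 : ℝ)..1, (1 / 2 : ℝ) * omega (c t) (deriv c t)

/-- The nowhere vanishing function `f` has a continuous argument that increases by `2πm` over
each period. (Only the argument of `f` has to be `1`-periodic modulo `2π`, not `f` itself.) -/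
def HasWindingNumber (f : ℝ → ℂ) (m : ℤ) : Prop :=
  ∃ θ : ℝ → ℝ, Continuous θ ∧
    (∀ t, f t ≠ 0 ∧ f t = (‖f t‖ : ℂ) * Complex.exp (θ t * Complex.I)) ∧
    ∀ t, θ (t + 1) = θ t + 2 * Real.pi * m

/-- The Maslov index of a loop `Λ` of Lagrangian planes of `ℂ²`: the winding number of the square
of the complex determinant of a continuous real frame of `Λ`. -/
def HasMaslovIndex (Λ : ℝ → Submodule ℝ C2) (m : ℤ) : Prop :=
  ∃ v w : ℝ → C2, Continuous v ∧ Continuous w ∧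
    (∀ t, LinearIndependent ℝ ![v t, w t] ∧ Λ t = Submodule.span ℝ {v t, w t}) ∧
    HasWindingNumber (fun t => ((v t).1 * (w t).2 - (v t).2 * (w t).1) ^ 2) m

/-- The area class of the torus `F` takes the value `r` on `e`. -/
def AreaClassEq (F : ℝ × ℝ → C2) (e : ℤ × ℤ) (r : ℝ) : Prop :=
  ∀ γ, IsLoopOfClass γ e → liouvilleIntegral (F ∘ γ) = r

/-- The Maslov class of the torus `F` takes the value `m` on `e`. -/
def MaslovClassEq (F : ℝ × ℝ → C2) (e : ℤ × ℤ) (m : ℤ) : Prop :=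
  ∀ γ, IsLoopOfClass γ e →
    HasMaslovIndex (fun t => LinearMap.range (fderiv ℝ F (γ t) : ℝ × ℝ →ₗ[ℝ] C2)) m

/-- The class `e` of the torus `F` has linking number `m` with the complex line `{z = a}`.
The linking number of a loop with `{z = a}` (the intersection number of a spanning disc with
this line) is the winding number of `z - a` along the loop. -/
def LinkingZEq (F : ℝ × ℝ → C2) (e : ℤ × ℤ) (a : ℂ) (m : ℤ) : Prop :=
  ∀ γ, IsLoopOfClass γ e → HasWindingNumber (fun t => (F (γ t)).1 - a) m

/-- The class `e` of the torus `F` has linking number `m` with the complex line `{w = b}`. -/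
def LinkingWEq (F : ℝ × ℝ → C2) (e : ℤ × ℤ) (b : ℂ) (m : ℤ) : Prop :=
  ∀ γ, IsLoopOfClass γ e → HasWindingNumber (fun t => (F (γ t)).2 - b) m

/-- The universal cover `ℝ × D` of the solid torus `ℝ/ℤ × D`, `D` the closed unit disc. -/
def solidCover : Set (ℝ × ℂ) := {q | ‖q.2‖ ≤ 1}

/-- `G` induces a smooth embedding of the solid torus `ℝ/ℤ × D` in `ℂ²`. As usual on a manifold
with boundary, smooth means that there is a smooth extension across the boundary; the values of
`G` off `ℝ × D` play no role. -/
structure IsEmbeddedSolidTorus (G : ℝ × ℂ → C2) : Prop where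
  smooth : ContDiff ℝ ∞ G
  eq_iff : ∀ p ∈ solidCover, ∀ q ∈ solidCover,
    G p = G q ↔ (∃ k : ℤ, q.1 = p.1 + k) ∧ q.2 = p.2
  immersion : ∀ p ∈ solidCover, Function.Injective (fderiv ℝ G p)

/-- All the meridian discs `G ({s} × D)` are symplectic, and oriented by `omega`. -/
def HasSymplecticMeridians (G : ℝ × ℂ → C2) : Prop :=
  ∀ q ∈ solidCover,
    0 < omega (fderiv ℝ G q ((0 : ℝ), (1 : ℂ))) (fderiv ℝ G q ((0 : ℝ), Complex.I))

/-- The boundary of every meridian disc `G ({s} × D)` is a loop in the torus `F`, of class `e`. -/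
def MeridianBoundaryClass (G : ℝ × ℂ → C2) (F : ℝ × ℝ → C2) (e : ℤ × ℤ) : Prop :=
  ∀ s : ℝ, ∃ γ, IsLoopOfClass γ e ∧
    ∀ t : ℝ, G (s, Complex.exp (2 * Real.pi * t * Complex.I)) = F (γ t)

/-- All leaves of the characteristic foliation of the solid torus `G` are closed: through every
point there is a regular closed curve (with lift `c` to `ℝ × D`) which is everywhere tangent to
the kernel of the restriction of `omega` to the solid torus. -/
def HasClosedCharacteristicLeaves (G : ℝ × ℂ → C2) : Prop :=
  ∀ q ∈ solidCover, ∃ c : ℝ → ℝ × ℂ, ContDiff ℝ ∞ c ∧ c 0 = q ∧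
    (∀ t, c t ∈ solidCover) ∧
    (∃ k : ℤ, ∀ t, c (t + 1) = c t + ((k : ℝ), (0 : ℂ))) ∧
    ∀ t, deriv c t ≠ 0 ∧
      ∀ u : ℝ × ℂ, omega (fderiv ℝ G (c t) (deriv c t)) (fderiv ℝ G (c t) u) = 0

end LagTorus

end

/-!
The torus is the boundary of a solid torus swept out by a disc that moves along a spiral.

In action-angle coordinates `z ↦ (r, θ)`, `w ↦ (u, φ)`, where `r` and `u` are the areas of the
discs through `z` and `w` and angles are measured in full turns, the symplectic form is
`dr ∧ dθ + du ∧ dφ`. The moving disc lies over a disc of area one in the `w`-plane, contained in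
the half disc `0 < u < 2h`, `|φ| < 1/4` of area `h` slightly larger than one (`exists_profile`).
At the time `s ∈ ℝ/ℤ` its points are `(r(s) - l(s) (2h - u), θ(s), u, φ + ρ(s))`: the disc is
transported along a closed curve `(r, θ)` in the `z`-plane, rotated by `ρ` in the `w`-plane, and
sheared by the amount `l`. If `ρ' = -l θ'`, then the velocity is everywhere in the kernel of the
pull-back of `ω` to the solid torus (`Steering.omega_fderiv_solid`). Hence the boundary is
Lagrangian, the meridian discs are symplectic, and the leaves of the characteristic foliation are
the closed curves traced by the points of the disc. The disc makes one negative turn in the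
`w`-plane in every period, and the curve `(r, θ)` turns back twice.

For the sweep to be embedded, positions of the disc that meet in the first factor have to differ by
half a turn in the second, where they lie in complementary half discs. The curve `(r, θ)` spirals
`M` times around the origin along a first branch (`SpiralParams`), with `θ` increasing, and
returns along a second branch that crosses the first one. The disc is rotated by half a turn in the
last turn of each branch, so that elsewhere the two branches are half a turn apart in the
`w`-plane and may cross freely. Where it is rotated, the shear pushes the disc off to the side on
which there is no other part of the spiral: `Steering.inj` is proved in
`SpiralParams.inj_of_nonneg` by comparing the actions along the two branches.

A half turn of the disc requires `∫ l dθ = ±1/2` over one turn of the spiral, so `|l|` can be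
kept below a number close to `1/2`. Since the action of the centre is close to `1`, the action in
the first factor is at most about `1 + (2h - u) / 2`. It stays below a number close to `2`, and so
does `u`, while their sum stays below a number close to `3`; hence the torus is contained in the
given neighbourhood (`SpiralParams.solid_bounds`). The area enclosed by the two branches of the
spiral is proportional to the number of turns times the variation `α` of the action of its centre;
with many turns it takes any prescribed positive value while `α` is as small as desired
(`exists_spiralParams`). This gives area `x - 3` to the class `(1, 0)` of the motion, and the
class `(0, 1)` of the meridian has area one. The Maslov indices of these classes are `-4` and `2`,
which yields the basis `(1, 3)`, `(0, 1)`.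

The line `{w = 0}` is linked `-1` times by the motion. For the other line, choose `a` just
outside the beginning of the returning branch and inside all other parts of the spiral that meet
the ray through `a`. Then the motion crosses the segment from `0` to `a` exactly once; since it
does not wind around `0`, it winds once around `a` (`HasArgument.of_crossing`,
`Steering.hasArgument_torus_fst_sub`).
-/

noncomputable section

namespace LagTorus

/-! ### Continuous arguments of functions on the universal cover of a torus -/

/-- The nowhere vanishing function `f` on `ℝ²` has a continuous argument that increases by `2πm`
along the first period and by `2πn` along the second. -/
def HasArgument (f : ℝ × ℝ → ℂ) (m n : ℤ) : Prop :=
  ∃ A : ℝ × ℝ → ℝ, Continuous A ∧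
    (∀ p, f p ≠ 0 ∧ f p = (‖f p‖ : ℂ) * Complex.exp (A p * Complex.I)) ∧
    ∀ (p : ℝ × ℝ) (k l : ℤ), A (p + ((k : ℝ), (l : ℝ))) = A p + 2 * Real.pi * (k * m + l * n)

lemma HasArgument.mul {f g : ℝ × ℝ → ℂ} {m n m' n' : ℤ} (hf : HasArgument f m n)
    (hg : HasArgument g m' n') : HasArgument (fun p => f p * g p) (m + m') (n + n') := by
  obtain ⟨A, hA, hA', hA''⟩ := hf
  obtain ⟨B, hB, hB', hB''⟩ := hg
  refine ⟨fun p => A p + B p, hA.add hB, fun p => ⟨mul_ne_zero (hA' p).1 (hB' p).1, ?_⟩,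
    fun p k l => ?_⟩
  · beta_reduce
    conv_lhs => rw [(hA' p).2, (hB' p).2]
    push_cast
    rw [norm_mul, add_mul, Complex.exp_add]
    push_cast
    ring
  · beta_reduce
    rw [hA'', hB'']
    push_cast
    ring

lemma HasArgument.of_slitPlane {f : ℝ × ℝ → ℂ} (hf : Continuous f)
    (hslit : ∀ p, f p ∈ Complex.slitPlane)
    (hper : ∀ (p : ℝ × ℝ) (k l : ℤ), f (p + ((k : ℝ), (l : ℝ))) = f p) : HasArgument f 0 0 := by
  refine ⟨fun p => Complex.arg (f p), ?_, fun p => ⟨Complex.slitPlane_ne_zero (hslit p), ?_⟩,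
    fun p k l => ?_⟩
  · exact continuous_iff_continuousAt.2 fun p =>
      (Complex.continuousAt_arg (hslit p)).comp hf.continuousAt
  · exact (Complex.norm_mul_exp_arg_mul_I (f p)).symm
  · simp [hper]

lemma HasArgument.of_polar {f : ℝ × ℝ → ℂ} {R A : ℝ × ℝ → ℝ} {m n : ℤ} (hR : ∀ p, 0 < R p)
    (hA : Continuous A) (hf : ∀ p, f p = (R p : ℂ) * Complex.exp (A p * Complex.I))
    (hper : ∀ (p : ℝ × ℝ) (k l : ℤ),
      A (p + ((k : ℝ), (l : ℝ))) = A p + 2 * Real.pi * (k * m + l * n)) : HasArgument f m n := by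
  refine ⟨A, hA, fun p => ?_, hper⟩
  have h : ‖f p‖ = R p := by
    rw [hf, norm_mul, Complex.norm_exp_ofReal_mul_I, mul_one, Complex.norm_real,
      Real.norm_of_nonneg (hR p).le]
  refine ⟨?_, by rw [h, hf]⟩
  rw [← norm_pos_iff, h]
  exact hR p

lemma HasArgument.congr {f g : ℝ × ℝ → ℂ} {m n : ℤ} (hf : HasArgument f m n)
    (h : ∀ p, g p = f p) : HasArgument g m n := by
  rwa [show g = f from funext h]

/-- Two functions whose quotient omits the negative real axis have arguments with the same
periods. -/
lemma HasArgument.of_div_slitPlane {f g : ℝ × ℝ → ℂ} {m n : ℤ} (hg : HasArgument g m n)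
    (hfc : Continuous f) (hgc : Continuous g) (hslit : ∀ p, f p / g p ∈ Complex.slitPlane)
    (hfper : ∀ (p : ℝ × ℝ) (k l : ℤ), f (p + ((k : ℝ), (l : ℝ))) = f p)
    (hgper : ∀ (p : ℝ × ℝ) (k l : ℤ), g (p + ((k : ℝ), (l : ℝ))) = g p) : HasArgument f m n := by
  have h0 : ∀ p, g p ≠ 0 := fun p => hg.choose_spec.2.1 p |>.1
  have h1 : HasArgument (fun p => f p / g p) 0 0 :=
    .of_slitPlane (hfc.div hgc h0) hslit fun p k l => by simp only [hfper, hgper]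
  have := h1.mul hg
  rw [zero_add, zero_add] at this
  exact this.congr fun p => (div_mul_cancel₀ _ (h0 p)).symm

lemma HasArgument.hasWindingNumber {f : ℝ × ℝ → ℂ} {m n : ℤ} (hf : HasArgument f m n)
    {γ : ℝ → ℝ × ℝ} {e : ℤ × ℤ} (hγ : IsLoopOfClass γ e) :
    HasWindingNumber (fun t => f (γ t)) (e.1 * m + e.2 * n) := by
  obtain ⟨A, hA, hA', hA''⟩ := hf
  refine ⟨fun t => A (γ t), hA.comp hγ.1.continuous, fun t => hA' (γ t), fun t => ?_⟩
  beta_reduce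
  rw [hγ.2, hA'']
  push_cast
  ring

lemma exists_const_of_exp_eq_one {X : Type*} [TopologicalSpace X] {S : Set X}
    (hS : IsPreconnected S) {f : X → ℂ} (hf : ContinuousOn f S)
    (h : ∀ x ∈ S, Complex.exp (f x) = 1) : ∃ c, ∀ x ∈ S, f x = c := by
  have hT : IsDiscrete (AddSubgroup.zmultiples (2 * Real.pi * Complex.I) : Set ℂ) :=
    ⟨NormedSpace.discreteTopology_zmultiples _⟩
  obtain ⟨c, -, hc⟩ := hS.eqOn_const_of_mapsTo hT hf (fun x hx => by
    obtain ⟨n, hn⟩ := Complex.exp_eq_one_iff.1 (h x hx)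
    exact ⟨n, by simp [hn]⟩) ⟨0, zero_mem _⟩
  exact ⟨c, hc⟩

/-- A doubly periodic function that meets the negative real axis only on the lines
`s ∈ s₀ + ℤ`, and crosses it from above to below at `(s₀, 0)`, turns once around the origin
along the first period. -/
lemma HasArgument.of_crossing {W : ℝ × ℝ → ℂ} (hW : Continuous W)
    (hper : ∀ (p : ℝ × ℝ) (k l : ℤ), W (p + ((k : ℝ), (l : ℝ))) = W p)
    (hne : ∀ p, W p ≠ 0) {s₀ : ℝ}
    (hslit : ∀ s t : ℝ, s₀ < s → s < s₀ + 1 → W (s, t) ∈ Complex.slitPlane)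
    (hre : (W (s₀, 0)).re < 0) (him : (W (s₀, 0)).im = 0)
    (hleft : ∀ᶠ s in 𝓝[<] s₀, 0 < (W (s, 0)).im)
    (hright : ∀ᶠ s in 𝓝[>] s₀, (W (s, 0)).im < 0) : HasArgument W 1 0 := by
  obtain ⟨L, hLc, hL⟩ : ∃ L : ℝ × ℝ → ℂ, ContinuousOn L univ ∧ EqOn (Complex.exp ∘ L) W univ := by
    refine Complex.exists_continuousOn_eqOn_exp_comp ?_ isOpen_univ hW.continuousOn
      (by rintro ⟨p, -, hp⟩; exact hne p hp)
    have := (convex_univ : Convex ℝ (univ : Set (ℝ × ℝ))).contractibleSpace ⟨0, trivial⟩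
    exact (inferInstance : SimplyConnectedSpace (univ : Set (ℝ × ℝ)))
  rw [continuousOn_univ] at hLc
  replace hL : ∀ p, Complex.exp (L p) = W p := fun p => hL (mem_univ p)
  have hnorm : ∀ p, W p = (‖W p‖ : ℂ) * Complex.exp ((L p).im * Complex.I) := fun p => by
    rw [← hL p, Complex.norm_exp, Complex.ofReal_exp, ← Complex.exp_add, Complex.re_add_im]
  -- On the strip, the continuous logarithm differs from the principal one by a constant.
  obtain ⟨c, hc⟩ : ∃ c : ℂ, ∀ s t : ℝ, s₀ < s → s < s₀ + 1 →
      L (s, t) = Complex.log (W (s, t)) + c := by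
    have hconv : Convex ℝ (Ioo s₀ (s₀ + 1) ×ˢ (univ : Set ℝ)) := (convex_Ioo _ _).prod convex_univ
    have hcont : ContinuousOn (fun p => L p - Complex.log (W p))
        (Ioo s₀ (s₀ + 1) ×ˢ (univ : Set ℝ)) := by
      refine hLc.continuousOn.sub fun p hp => ?_
      exact ((continuousAt_clog (hslit p.1 p.2 hp.1.1 hp.1.2)).comp
        hW.continuousAt).continuousWithinAt
    obtain ⟨c, hc⟩ := exists_const_of_exp_eq_one hconv.isPreconnected hcont fun p _ => by
      rw [Complex.exp_sub, hL, Complex.exp_log (hne p), div_self (hne p)]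
    exact ⟨c, fun s t h h' => by rw [← hc (s, t) ⟨⟨h, h'⟩, trivial⟩]; ring⟩
  -- The change of `L` along a period is constant.
  have hconst : ∀ k l : ℤ, ∃ d : ℂ, ∀ p : ℝ × ℝ, L (p + ((k : ℝ), (l : ℝ))) - L p = d := by
    intro k l
    obtain ⟨d, hd⟩ := exists_const_of_exp_eq_one (S := (univ : Set (ℝ × ℝ)))
      (f := fun p => L (p + ((k : ℝ), (l : ℝ))) - L p) isPreconnected_univ
      (by fun_prop) fun p _ => by
        rw [Complex.exp_sub, hL, hL, hper, div_self (hne p)]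
    exact ⟨d, fun p => hd p trivial⟩
  have hfst : ∀ p : ℝ × ℝ, (L (p + (1, 0))).im = (L p).im + 2 * Real.pi := by
    obtain ⟨d, hd⟩ := hconst 1 0
    have hd' : (L (s₀ + 1, 0)).im - (L (s₀, 0)).im = d.im := by
      have := hd (s₀, 0)
      rw [← this]
      simp
    have hto : Filter.Tendsto (fun s => W (s, 0)) (𝓝 s₀) (𝓝 (W (s₀, 0))) :=
      (hW.comp (by fun_prop : Continuous fun s : ℝ => (s, (0 : ℝ)))).tendsto s₀
    have hLto : ∀ s₁ : ℝ, Filter.Tendsto (fun s => (L (s, 0)).im) (𝓝 s₁) (𝓝 (L (s₁, 0)).im) :=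
      fun s₁ => (by fun_prop : Continuous fun s : ℝ => (L (s, 0)).im).tendsto s₁
    have h1 : (L (s₀, 0)).im = -Real.pi + c.im := by
      refine tendsto_nhds_unique ((hLto s₀).mono_left (nhdsWithin_le_nhds (s := Ioi s₀))) ?_
      have h : Filter.Tendsto (fun s => (W (s, 0)).arg + c.im) (𝓝[>] s₀)
          (𝓝 (-Real.pi + c.im)) := by
        refine Filter.Tendsto.add_const _ ?_
        exact (Complex.tendsto_arg_nhdsWithin_im_neg_of_re_neg_of_im_zero hre him).comp
          (tendsto_nhdsWithin_iff.2 ⟨hto.mono_left nhdsWithin_le_nhds, hright⟩)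
      refine h.congr' ?_
      filter_upwards [Ioo_mem_nhdsGT (show s₀ < s₀ + 1 by linarith)] with s hs
      rw [hc s 0 hs.1 hs.2, Complex.add_im, Complex.log_im]
    have h2 : (L (s₀ + 1, 0)).im = Real.pi + c.im := by
      have hsh : Filter.Tendsto (fun s : ℝ => s + 1) (𝓝[<] s₀) (𝓝 (s₀ + 1)) :=
        ((by fun_prop : Continuous fun s : ℝ => s + 1).tendsto s₀).mono_left nhdsWithin_le_nhds
      refine tendsto_nhds_unique ((hLto (s₀ + 1)).comp hsh) ?_
      have h : Filter.Tendsto (fun s => (W (s, 0)).arg + c.im) (𝓝[<] s₀)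
          (𝓝 (Real.pi + c.im)) := by
        refine Filter.Tendsto.add_const _ ?_
        exact (Complex.tendsto_arg_nhdsWithin_im_nonneg_of_re_neg_of_im_zero hre him).comp
          (tendsto_nhdsWithin_iff.2 ⟨hto.mono_left nhdsWithin_le_nhds,
            hleft.mono fun s hs => le_of_lt hs⟩)
      refine h.congr' ?_
      filter_upwards [Ioo_mem_nhdsLT (show s₀ - 1 < s₀ by linarith)] with s hs
      have := hper (s, 0) 1 0
      simp only [Prod.mk_add_mk, Int.cast_one, Int.cast_zero, add_zero] at this
      rw [Function.comp_apply, hc (s + 1) 0 (by linarith [hs.1]) (by linarith [hs.2]),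
        Complex.add_im, Complex.log_im, this]
    intro p
    have h3 : (L (p + (1, 0))).im - (L p).im = d.im := by
      rw [← hd p]
      simp
    linarith
  have hsnd : ∀ p : ℝ × ℝ, (L (p + (0, 1))).im = (L p).im := by
    obtain ⟨d, hd⟩ := hconst 0 1
    have hd' : d = 0 := by
      have h := hper (s₀ + 1 / 2, 0) 0 1
      have h1 := hd (s₀ + 1 / 2, 0)
      simp only [Prod.mk_add_mk, Int.cast_one, Int.cast_zero, add_zero, zero_add] at h h1
      rw [← h1, hc _ _ (by linarith) (by linarith), hc _ _ (by linarith) (by linarith), h]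
      ring
    intro p
    have h3 : (L (p + (0, 1))).im - (L p).im = d.im := by
      rw [← hd p]
      simp
    rw [hd', Complex.zero_im] at h3
    linarith
  refine ⟨fun p => (L p).im, by fun_prop, fun p => ⟨hne p, hnorm p⟩, fun p k l => ?_⟩
  -- Removing the linear part of the period map leaves a doubly periodic function.
  have e1 : Function.Periodic (fun p : ℝ × ℝ => (L p).im - 2 * Real.pi * p.1) (1, 0) := fun p => by
    simp only [hfst, Prod.fst_add]
    ring
  have e2 : Function.Periodic (fun p : ℝ × ℝ => (L p).im - 2 * Real.pi * p.1) (0, 1) := fun p => by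
    simp only [hsnd, Prod.fst_add]
    ring
  have e3 := (e2.zsmul l (p + k • ((1 : ℝ), (0 : ℝ)))).trans (e1.zsmul k p)
  have e4 : p + k • ((1 : ℝ), (0 : ℝ)) + l • ((0 : ℝ), (1 : ℝ)) = p + ((k : ℝ), (l : ℝ)) := by
    ext <;> simp
  beta_reduce at e3 ⊢
  rw [e4] at e3
  simp only [Prod.fst_add] at e3
  push_cast
  linarith

/-! ### Action-angle coordinates -/

/-- The point of the plane with action coordinate `r` (the area of the disc through the point)
and angle coordinate `θ`, measured in full turns. -/
def polar (r θ : ℝ) : ℂ := (√(r / Real.pi) : ℂ) * Complex.exp ((2 * Real.pi * θ : ℝ) * Complex.I)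

lemma norm_polar (r θ : ℝ) : ‖polar r θ‖ = √(r / Real.pi) := by
  rw [polar, norm_mul, Complex.norm_exp_ofReal_mul_I, mul_one, Complex.norm_real,
    Real.norm_of_nonneg (Real.sqrt_nonneg _)]

lemma pi_mul_norm_polar_sq {r : ℝ} (hr : 0 ≤ r) (θ : ℝ) : Real.pi * ‖polar r θ‖ ^ 2 = r := by
  rw [norm_polar, Real.sq_sqrt (by positivity)]
  field_simp

lemma polar_ne_zero {r : ℝ} (hr : 0 < r) (θ : ℝ) : polar r θ ≠ 0 := by
  rw [← norm_pos_iff, norm_polar]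
  positivity

lemma polar_eq_iff {r r' θ θ' : ℝ} (hr : 0 < r) (hr' : 0 < r') :
    polar r θ = polar r' θ' ↔ r = r' ∧ ∃ k : ℤ, θ' = θ + k := by
  constructor
  · intro h
    have h1 : r = r' := by
      rw [← pi_mul_norm_polar_sq hr.le θ, h, pi_mul_norm_polar_sq hr'.le]
    refine ⟨h1, ?_⟩
    have h0 : (√(r / Real.pi) : ℂ) ≠ 0 := by
      have : 0 < √(r / Real.pi) := by positivity
      exact_mod_cast this.ne'
    rw [polar, polar, ← h1] at h
    obtain ⟨n, hn⟩ := Complex.exp_eq_exp_iff_exists_int.1 (mul_left_cancel₀ h0 h).symm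
    refine ⟨n, ?_⟩
    have h2 : ((2 * Real.pi * θ' : ℝ) : ℂ) = ((2 * Real.pi * θ + n * (2 * Real.pi) : ℝ) : ℂ) := by
      apply mul_right_cancel₀ Complex.I_ne_zero
      rw [hn]
      push_cast
      ring
    have h3 := Complex.ofReal_injective h2
    have := Real.pi_pos
    nlinarith
  · rintro ⟨rfl, k, rfl⟩
    rw [polar, polar]
    congr 1
    rw [Complex.exp_eq_exp_iff_exists_int]
    exact ⟨-k, by push_cast; ring⟩

section Deriv

variable {E : Type*} [NormedAddCommGroup E] [NormedSpace ℝ E]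

lemma contDiff_polar {R T : E → ℝ} (hR : ContDiff ℝ ∞ R) (hT : ContDiff ℝ ∞ T)
    (hpos : ∀ p, 0 < R p) : ContDiff ℝ ∞ fun p => polar (R p) (T p) := by
  have hpi := Real.pi_pos
  have h1 : ContDiff ℝ ∞ fun p => √(R p / Real.pi) :=
    (hR.div_const _).sqrt fun p => (div_pos (hpos p) hpi).ne'
  have h2 : ContDiff ℝ ∞ fun p => ((√(R p / Real.pi) : ℝ) : ℂ) :=
    Complex.ofRealCLM.contDiff.comp h1
  have h3 : ContDiff ℝ ∞ fun p => ((2 * Real.pi * T p : ℝ) : ℂ) :=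
    Complex.ofRealCLM.contDiff.comp (contDiff_const.mul hT)
  exact h2.mul ((h3.mul contDiff_const).cexp)

/-- The logarithmic differential of the polar map: `dz = z (dr / 2r + 2πi dθ)`. -/
lemma hasFDerivAt_polar {R T : E → ℝ} {R' T' : E →L[ℝ] ℝ} {p : E} (hR : HasFDerivAt R R' p)
    (hT : HasFDerivAt T T' p) (hpos : 0 < R p) :
    ∃ f' : E →L[ℝ] ℂ, HasFDerivAt (fun p => polar (R p) (T p)) f' p ∧
      ∀ v, f' v = polar (R p) (T p) *
        ((R' v / (2 * R p) : ℝ) + (2 * Real.pi * T' v : ℝ) * Complex.I) := by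
  have hpi := Real.pi_pos
  have h1 := (hR.mul_const Real.pi⁻¹).sqrt (mul_pos hpos (inv_pos.2 hpi)).ne'
  have h2 := Complex.ofRealCLM.hasFDerivAt.comp p h1
  have h3 := Complex.ofRealCLM.hasFDerivAt.comp p (hT.const_mul (2 * Real.pi))
  have h4 := h2.mul ((h3.mul_const Complex.I).cexp)
  refine ⟨_, h4, fun v => ?_⟩
  have hs : ((√(R p * Real.pi⁻¹) : ℝ) : ℂ) ^ 2 = R p * (Real.pi : ℂ)⁻¹ := by
    rw [← Complex.ofReal_pow, Real.sq_sqrt (by positivity)]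
    push_cast
    rfl
  have h0 : ((√(R p * Real.pi⁻¹) : ℝ) : ℂ) ≠ 0 := by
    have : 0 < √(R p * Real.pi⁻¹) := by positivity
    exact_mod_cast this.ne'
  have hRp : (R p : ℂ) ≠ 0 := by exact_mod_cast hpos.ne'
  have hpi' : (Real.pi : ℂ) ≠ 0 := by exact_mod_cast hpi.ne'
  simp only [polar, Function.comp_apply, div_eq_mul_inv (R p) Real.pi, Complex.ofRealCLM_apply,
    add_apply, smul_apply, smul_eq_mul,
    ContinuousLinearMap.comp_apply]
  set q : ℂ := ((√(R p * Real.pi⁻¹) : ℝ) : ℂ) with hq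
  have hR2 : (R p : ℂ) = q ^ 2 * Real.pi := by rw [hs]; field_simp
  push_cast
  simp only [← hq, hR2]
  field_simp
  ring

/-- The differential of a map to `ℂ²` given in action-angle coordinates. -/
lemma hasFDerivAt_polar_polar {R T U P : E → ℝ} {R' T' U' P' : E →L[ℝ] ℝ} {p : E}
    (hR : HasFDerivAt R R' p) (hT : HasFDerivAt T T' p) (hU : HasFDerivAt U U' p)
    (hP : HasFDerivAt P P' p) (hRpos : 0 < R p) (hUpos : 0 < U p) (v : E) :
    fderiv ℝ (fun p => (polar (R p) (T p), polar (U p) (P p))) p v =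
      (polar (R p) (T p) * ((R' v / (2 * R p) : ℝ) + (2 * Real.pi * T' v : ℝ) * Complex.I),
        polar (U p) (P p) * ((U' v / (2 * U p) : ℝ) + (2 * Real.pi * P' v : ℝ) * Complex.I)) := by
  obtain ⟨f', hf, hf'⟩ := hasFDerivAt_polar hR hT hRpos
  obtain ⟨g', hg, hg'⟩ := hasFDerivAt_polar hU hP hUpos
  rw [(hf.prodMk hg).fderiv, ContinuousLinearMap.prod_apply, hf', hg']

end Deriv

/-- The standard symplectic form is `dr ∧ dθ + du ∧ dφ` in action-angle coordinates. -/
lemma omega_polar {r u : ℝ} (hr : 0 < r) (hu : 0 < u) (θ φ a b c d a' b' c' d' : ℝ) :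
    omega
      (polar r θ * ((a / (2 * r) : ℝ) + (2 * Real.pi * b : ℝ) * Complex.I),
        polar u φ * ((c / (2 * u) : ℝ) + (2 * Real.pi * d : ℝ) * Complex.I))
      (polar r θ * ((a' / (2 * r) : ℝ) + (2 * Real.pi * b' : ℝ) * Complex.I),
        polar u φ * ((c' / (2 * u) : ℝ) + (2 * Real.pi * d' : ℝ) * Complex.I)) =
      (a * b' - a' * b) + (c * d' - c' * d) := by
  have key : ∀ (z : ℂ) (a b a' b' : ℝ),
      (z * ((a : ℂ) + b * Complex.I)).re * (z * ((a' : ℂ) + b' * Complex.I)).im -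
        (z * ((a : ℂ) + b * Complex.I)).im * (z * ((a' : ℂ) + b' * Complex.I)).re =
      ‖z‖ ^ 2 * (a * b' - a' * b) := by
    intro z a b a' b'
    rw [Complex.sq_norm, Complex.normSq_apply]
    simp
    ring
  have hpi := Real.pi_pos
  rw [omega, key, key, norm_polar, norm_polar, Real.sq_sqrt (by positivity),
    Real.sq_sqrt (by positivity)]
  field_simp

/-- The Liouville form is `r dθ + u dφ` in action-angle coordinates. -/
lemma half_omega_polar_radial {r u : ℝ} (hr : 0 < r) (hu : 0 < u) (θ φ a b c d : ℝ) :
    (1 / 2 : ℝ) * omega (polar r θ, polar u φ)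
      (polar r θ * ((a / (2 * r) : ℝ) + (2 * Real.pi * b : ℝ) * Complex.I),
        polar u φ * ((c / (2 * u) : ℝ) + (2 * Real.pi * d : ℝ) * Complex.I)) = r * b + u * d := by
  have h := omega_polar hr hu θ φ (2 * r) 0 (2 * u) 0 a b c d
  rw [div_self (by positivity), div_self (by positivity)] at h
  simp only [mul_zero, Complex.ofReal_one, Complex.ofReal_zero, zero_mul, add_zero, mul_one,
    sub_zero] at h
  rw [h]
  ring

/-! ### The solid torus swept out by a disc along a closed curve -/

/-- A profile: a smooth diffeomorphism from the line onto a bounded interval contained in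
`(-1, 1)`. Its square maps round discs to discs that nearly fill a square. -/
structure IsProfile (g : ℝ → ℝ) : Prop where
  smooth : ContDiff ℝ ∞ g
  deriv_pos : ∀ y, 0 < deriv g y
  lower : ∀ y, -1 < g y
  upper : ∀ y, g y < 1

lemma IsProfile.strictMono {g : ℝ → ℝ} (hg : IsProfile g) : StrictMono g :=
  strictMono_of_deriv_pos hg.deriv_pos

/-- The data that steer a disc of actions `0 < u < 2h` through `ℂ²`. In the first factor, the
centre of the motion is the closed curve with action `r` and angle `θ`; points of the disc with
action `u` are displaced in the radial direction by `-l (2h - u)`. In the second factor, the disc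
is rotated by the angle `ρ`. The relation between `ρ`, `l` and `θ` says that the motion is
Hamiltonian, and `inj` that the disc never hits an earlier position of itself: when two positions
meet in the first factor, they differ by half a turn in the second one. The condition `turn` says
that the closed curve has non-zero radial velocity where its angular velocity vanishes, directed
such that the velocity vector rotates in the negative sense there. -/
structure Steering (h : ℝ) where
  θ : ℝ → ℝ
  r : ℝ → ℝ
  l : ℝ → ℝ
  ρ : ℝ → ℝ
  speed : ℝ
  h_pos : 0 < h
  θ_smooth : ContDiff ℝ ∞ θ
  r_smooth : ContDiff ℝ ∞ r
  l_smooth : ContDiff ℝ ∞ l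
  ρ_smooth : ContDiff ℝ ∞ ρ
  θ_add_one : ∀ s, θ (s + 1) = θ s
  r_add_one : ∀ s, r (s + 1) = r s
  l_add_one : ∀ s, l (s + 1) = l s
  ρ_add_one : ∀ s, ρ (s + 1) = ρ s - 1
  speed_pos : 0 < speed
  deriv_θ : ∀ s, deriv θ s = speed * Real.sin (2 * Real.pi * s)
  deriv_ρ : ∀ s, deriv ρ s = -(l s * deriv θ s)
  pos : ∀ s v, 0 < v → v < 2 * h → 0 < r s - l s * v
  inj : ∀ (s s' v : ℝ) (k : ℤ), 0 < v → v < 2 * h → θ s' = θ s + k →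
    r s - l s * v = r s' - l s' * v →
    (∃ n : ℤ, s' = s + n) ∨ ∃ n : ℤ, ρ s' = ρ s + n + 1 / 2
  turn : ∀ s, Real.sin (2 * Real.pi * s) = 0 →
    l s = 0 ∧ deriv l s = 0 ∧ deriv r s * Real.cos (2 * Real.pi * s) < 0

namespace Steering

variable {h : ℝ} (D : Steering h) {g : ℝ → ℝ}

/-- The action in the first factor of the points of the disc whose action in the second factor
is `h (1 + y)`. -/
def radius (s y : ℝ) : ℝ := D.r s - D.l s * (h * (1 - y))

/-- The solid torus swept out by the disc. -/
def solid (g : ℝ → ℝ) (q : ℝ × ℂ) : C2 :=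
  (polar (D.radius q.1 (g q.2.re)) (D.θ q.1),
    polar (h * (1 + g q.2.re)) (g q.2.im / 4 + D.ρ q.1))

/-- The universal cover of the boundary of the cover of the solid torus. -/
def boundaryCover (p : ℝ × ℝ) : ℝ × ℂ :=
  (p.1, Complex.exp (2 * Real.pi * p.2 * Complex.I))

/-- The torus swept out by the boundary of the disc. -/
def torus (g : ℝ → ℝ) (p : ℝ × ℝ) : C2 := D.solid g (boundaryCover p)

lemma action_pos (D : Steering h) (hg : IsProfile g) (y : ℝ) : 0 < h * (1 + g y) :=
  mul_pos D.h_pos (by linarith [hg.lower y])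

lemma radius_pos (hg : IsProfile g) (s y : ℝ) : 0 < D.radius s (g y) :=
  D.pos s _ (mul_pos D.h_pos (by linarith [hg.upper y])) (by nlinarith [hg.lower y, D.h_pos])

lemma r_add_int (s : ℝ) (n : ℤ) : D.r (s + n) = D.r s := by
  have := (show Function.Periodic D.r 1 from D.r_add_one).int_mul n s
  rwa [mul_one] at this

lemma l_add_int (s : ℝ) (n : ℤ) : D.l (s + n) = D.l s := by
  have := (show Function.Periodic D.l 1 from D.l_add_one).int_mul n s
  rwa [mul_one] at this

lemma θ_add_int (s : ℝ) (n : ℤ) : D.θ (s + n) = D.θ s := by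
  have := (show Function.Periodic D.θ 1 from D.θ_add_one).int_mul n s
  rwa [mul_one] at this

lemma ρ_add_int (s : ℝ) (n : ℤ) : D.ρ (s + n) = D.ρ s - n := by
  have h1 : Function.Periodic (fun s => D.ρ s + s) 1 := fun s => by
    simp only [D.ρ_add_one]
    ring
  have := h1.int_mul n s
  simp only [mul_one] at this
  linarith

lemma radius_add_int (s y : ℝ) (n : ℤ) : D.radius (s + n) y = D.radius s y := by
  rw [radius, radius, r_add_int, l_add_int]

lemma contDiff_radius (hg : IsProfile g) :
    ContDiff ℝ ∞ fun q : ℝ × ℂ => D.radius q.1 (g q.2.re) := by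
  have hre : ContDiff ℝ ∞ fun q : ℝ × ℂ => g q.2.re :=
    hg.smooth.comp (Complex.reCLM.contDiff.comp contDiff_snd)
  have h1 : ContDiff ℝ ∞ fun q : ℝ × ℂ => D.r q.1 := D.r_smooth.comp contDiff_fst
  have h2 : ContDiff ℝ ∞ fun q : ℝ × ℂ => D.l q.1 := D.l_smooth.comp contDiff_fst
  exact h1.sub (h2.mul (contDiff_const.mul (contDiff_const.sub hre)))

lemma contDiff_solid (hg : IsProfile g) : ContDiff ℝ ∞ (D.solid g) := by
  have hre : ContDiff ℝ ∞ fun q : ℝ × ℂ => g q.2.re :=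
    hg.smooth.comp (Complex.reCLM.contDiff.comp contDiff_snd)
  have him : ContDiff ℝ ∞ fun q : ℝ × ℂ => g q.2.im :=
    hg.smooth.comp (Complex.imCLM.contDiff.comp contDiff_snd)
  have h1 : ContDiff ℝ ∞ fun q : ℝ × ℂ => D.θ q.1 := D.θ_smooth.comp contDiff_fst
  have h2 : ContDiff ℝ ∞ fun q : ℝ × ℂ => D.ρ q.1 := D.ρ_smooth.comp contDiff_fst
  exact (contDiff_polar (D.contDiff_radius hg) h1 fun q => D.radius_pos hg _ _).prodMk
    (contDiff_polar (contDiff_const.mul (contDiff_const.add hre)) ((him.div_const _).add h2)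
      fun q => D.action_pos hg _)

/-- The derivative of `radius` along the tangent vector `v` of the solid torus. -/
def radiusDeriv (g : ℝ → ℝ) (q : ℝ × ℂ) (v : ℝ × ℂ) : ℝ :=
  (deriv D.r q.1 - deriv D.l q.1 * (h * (1 - g q.2.re))) * v.1 +
    D.l q.1 * (h * (deriv g q.2.re * v.2.re))

lemma fderiv_solid (hg : IsProfile g) (q v : ℝ × ℂ) :
    fderiv ℝ (D.solid g) q v =
      ((D.solid g q).1 * ((D.radiusDeriv g q v / (2 * D.radius q.1 (g q.2.re)) : ℝ) +
          (2 * Real.pi * (deriv D.θ q.1 * v.1) : ℝ) * Complex.I),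
        (D.solid g q).2 * ((h * (deriv g q.2.re * v.2.re) / (2 * (h * (1 + g q.2.re))) : ℝ) +
          (2 * Real.pi * (deriv g q.2.im * v.2.im / 4 + deriv D.ρ q.1 * v.1) : ℝ) *
            Complex.I)) := by
  have one_le : (∞ : WithTop ℕ∞) ≠ 0 := by simp
  have hcomp : ∀ {f : ℝ → ℝ}, ContDiff ℝ ∞ f → ∀ (L : ℝ × ℂ →L[ℝ] ℝ),
      HasFDerivAt (fun q => f (L q)) (deriv f (L q) • L) q := fun {f} hf L =>
    ((hf.differentiable one_le).differentiableAt.hasDerivAt).comp_hasFDerivAt q L.hasFDerivAt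
  let L1 := ContinuousLinearMap.fst ℝ ℝ ℂ
  let L2 := Complex.reCLM.comp (ContinuousLinearMap.snd ℝ ℝ ℂ)
  let L3 := Complex.imCLM.comp (ContinuousLinearMap.snd ℝ ℝ ℂ)
  have hre := hcomp hg.smooth L2
  have hR := (hcomp D.r_smooth L1).sub ((hcomp D.l_smooth L1).mul ((hre.const_sub 1).const_mul h))
  have hU := (hre.const_add 1).const_mul h
  have hP := ((hcomp hg.smooth L3).mul_const (4⁻¹ : ℝ)).add (hcomp D.ρ_smooth L1)
  have key := hasFDerivAt_polar_polar hR (hcomp D.θ_smooth L1) hU hP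
    (D.radius_pos hg _ _) (D.action_pos hg _) v
  refine Eq.trans ?_ (key.trans (Prod.ext ?_ ?_))
  · rfl
  · simp only [solid, radiusDeriv]
    congr 4
    simp [L1, L2]
    ring
  · simp only [solid]
    congr 4
    simp [L1, L3]
    ring

/-- The pull-back of the symplectic form to the solid torus is an area form on the disc factor:
this is where the relation between rotation and displacement enters. -/
lemma omega_fderiv_solid (hg : IsProfile g) (q v v' : ℝ × ℂ) :
    omega (fderiv ℝ (D.solid g) q v) (fderiv ℝ (D.solid g) q v') =
      h / 4 * deriv g q.2.re * deriv g q.2.im * (v.2.re * v'.2.im - v'.2.re * v.2.im) := by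
  rw [fderiv_solid D hg, fderiv_solid D hg]
  refine (omega_polar (D.radius_pos hg _ _) (D.action_pos hg _) _ _ _ _ _ _ _ _ _ _).trans ?_
  rw [D.deriv_ρ, radiusDeriv, radiusDeriv]
  ring

lemma fderiv_solid_injective (hg : IsProfile g) (q : ℝ × ℂ) :
    Function.Injective (fderiv ℝ (D.solid g) q) := by
  rw [injective_iff_map_eq_zero]
  intro v hv
  have hpos : 0 < h / 4 * deriv g q.2.re * deriv g q.2.im :=
    mul_pos (mul_pos (by linarith [D.h_pos]) (hg.deriv_pos _)) (hg.deriv_pos _)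
  have homega : ∀ v' : ℝ × ℂ, v.2.re * v'.2.im - v'.2.re * v.2.im = 0 := fun v' => by
    have h1 := D.omega_fderiv_solid hg q v v'
    rw [hv] at h1
    have h2 : omega 0 (fderiv ℝ (D.solid g) q v') = 0 := by simp [omega]
    rw [h2] at h1
    exact (mul_eq_zero.1 h1.symm).resolve_left hpos.ne'
  have hx : v.2.re = 0 := by simpa using homega (0, Complex.I)
  have hy : v.2.im = 0 := by simpa using homega (0, 1)
  have h1 := congrArg Prod.fst hv
  rw [fderiv_solid D hg] at h1
  have h2 := (mul_eq_zero.1 h1).resolve_left (polar_ne_zero (D.radius_pos hg _ _) _)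
  have him := congrArg Complex.im h2
  have hre := congrArg Complex.re h2
  simp only [Complex.add_re, Complex.add_im, Complex.ofReal_re, Complex.ofReal_im,
    Complex.re_ofReal_mul, Complex.im_ofReal_mul, Complex.I_re, Complex.I_im, mul_zero, mul_one,
    add_zero, zero_add, Complex.zero_re, Complex.zero_im] at him hre
  have hσ : v.1 = 0 := by
    by_contra hσ
    have hpi := Real.pi_pos
    have hs : Real.sin (2 * Real.pi * q.1) = 0 := by
      rw [D.deriv_θ] at him
      have := D.speed_pos
      simpa [hpi.ne', this.ne', hσ] using him
    obtain ⟨-, hl', hr⟩ := D.turn q.1 hs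
    have hR := D.radius_pos hg q.1 q.2.re
    rw [radiusDeriv, hx, hl', div_eq_zero_iff] at hre
    rcases hre with hre | hre
    · simp [hσ] at hre
      rw [hre] at hr
      simp at hr
    · linarith
  exact Prod.ext hσ (Complex.ext hx hy)

lemma solid_eq_iff (hg : IsProfile g) (p q : ℝ × ℂ) :
    D.solid g p = D.solid g q ↔ (∃ k : ℤ, q.1 = p.1 + k) ∧ q.2 = p.2 := by
  have hh := D.h_pos
  constructor
  · intro heq
    obtain ⟨h1, h2⟩ := Prod.ext_iff.1 heq
    obtain ⟨hR, k, hk⟩ := (polar_eq_iff (D.radius_pos hg _ _) (D.radius_pos hg _ _)).1 h1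
    obtain ⟨hU, m, hm⟩ := (polar_eq_iff (D.action_pos hg _) (D.action_pos hg _)).1 h2
    have hre' : g p.2.re = g q.2.re := by
      have := mul_left_cancel₀ hh.ne' hU
      linarith
    have hre : p.2.re = q.2.re := hg.strictMono.injective hre'
    rw [radius, radius, hre'] at hR
    have h3 := hg.lower p.2.im
    have h4 := hg.upper p.2.im
    have h5 := hg.lower q.2.im
    have h6 := hg.upper q.2.im
    rcases D.inj p.1 q.1 _ k (mul_pos hh (by linarith [hg.upper q.2.re]))
      (by nlinarith [hg.lower q.2.re]) hk hR with ⟨n, hn⟩ | ⟨n, hn⟩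
    · refine ⟨⟨n, hn⟩, Complex.ext hre.symm ?_⟩
      rw [hn, ρ_add_int] at hm
      have h7 : g q.2.im - g p.2.im = 4 * ((m + n : ℤ) : ℝ) := by
        push_cast
        linarith
      have h8 : m + n = 0 := by
        have h9 : ((m + n : ℤ) : ℝ) < 1 := by linarith
        have h10 : (-1 : ℝ) < ((m + n : ℤ) : ℝ) := by linarith
        have h11 : m + n < 1 := by exact_mod_cast h9
        have h12 : -1 < m + n := by exact_mod_cast h10
        omega
      rw [h8] at h7
      exact hg.strictMono.injective (by simpa [sub_eq_zero] using h7)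
    · exfalso
      rw [hn] at hm
      have h7 : g q.2.im - g p.2.im = 4 * ((m - n : ℤ) : ℝ) - 2 := by
        push_cast
        linarith
      have h9 : ((m - n : ℤ) : ℝ) < 1 := by linarith
      have h10 : (0 : ℝ) < ((m - n : ℤ) : ℝ) := by linarith
      have h11 : m - n < 1 := by exact_mod_cast h9
      have h12 : 0 < m - n := by exact_mod_cast h10
      omega
  · rintro ⟨⟨k, hk⟩, h2⟩
    refine Prod.ext ((polar_eq_iff (D.radius_pos hg _ _) (D.radius_pos hg _ _)).2 ?_)
      ((polar_eq_iff (D.action_pos hg _) (D.action_pos hg _)).2 ?_)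
    · rw [hk, h2, radius_add_int, θ_add_int]
      exact ⟨rfl, 0, by simp⟩
    · rw [hk, h2, ρ_add_int]
      exact ⟨rfl, -k, by push_cast; ring⟩

lemma isEmbeddedSolidTorus (hg : IsProfile g) : IsEmbeddedSolidTorus (D.solid g) where
  smooth := D.contDiff_solid hg
  eq_iff p _ q _ := D.solid_eq_iff hg p q
  immersion p _ := D.fderiv_solid_injective hg p

lemma hasSymplecticMeridians (hg : IsProfile g) : HasSymplecticMeridians (D.solid g) := by
  intro q _
  rw [omega_fderiv_solid D hg]
  have := D.h_pos
  have := hg.deriv_pos q.2.re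
  have := hg.deriv_pos q.2.im
  simp
  positivity

lemma hasClosedCharacteristicLeaves (hg : IsProfile g) :
    HasClosedCharacteristicLeaves (D.solid g) := by
  intro q hq
  have hd : ∀ t : ℝ, HasDerivAt (fun t : ℝ => (q.1 + t, q.2)) ((1 : ℝ), (0 : ℂ)) t := fun t =>
    ((hasDerivAt_id t).const_add q.1).prodMk (hasDerivAt_const t q.2)
  refine ⟨fun t => (q.1 + t, q.2), (contDiff_const.add contDiff_id).prodMk contDiff_const,
    by simp, fun t => hq, ⟨1, fun t => ?_⟩, fun t => ⟨?_, fun u => ?_⟩⟩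
  · ext <;> simp [add_assoc]
  · rw [(hd t).deriv]
    simp
  · rw [(hd t).deriv, omega_fderiv_solid D hg]
    simp

lemma meridianBoundaryClass : MeridianBoundaryClass (D.solid g) (D.torus g) (0, 1) := by
  intro s
  refine ⟨fun t => (s, t), ⟨contDiff_const.prodMk contDiff_id, fun t => by simp⟩, fun t => rfl⟩

lemma range_torus : range (D.torus g) = D.solid g '' {q : ℝ × ℂ | ‖q.2‖ = 1} := by
  ext y
  constructor
  · rintro ⟨p, rfl⟩
    refine ⟨boundaryCover p, ?_, rfl⟩
    have := Complex.norm_exp_ofReal_mul_I (2 * Real.pi * p.2)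
    push_cast at this
    exact this
  · rintro ⟨q, hq, rfl⟩
    refine ⟨(q.1, Complex.arg q.2 / (2 * Real.pi)), ?_⟩
    have h1 := Complex.norm_mul_exp_arg_mul_I q.2
    rw [show ‖q.2‖ = 1 from hq, Complex.ofReal_one, one_mul] at h1
    have hpi : (Real.pi : ℂ) ≠ 0 := by exact_mod_cast Real.pi_ne_zero
    have h2 : boundaryCover (q.1, Complex.arg q.2 / (2 * Real.pi)) = q := by
      refine Prod.ext rfl ?_
      simp only [boundaryCover]
      rw [← h1]
      congr 1
      rw [h1]
      push_cast
      field_simp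
    rw [torus, h2]

lemma boundaryCover_snd (p : ℝ × ℝ) : (boundaryCover p).2 =
    (Real.cos (2 * Real.pi * p.2) : ℝ) + (Real.sin (2 * Real.pi * p.2) : ℝ) * Complex.I := by
  rw [boundaryCover, Complex.ofReal_cos, Complex.ofReal_sin, ← Complex.exp_mul_I]
  push_cast
  rfl

lemma boundaryCover_re (p : ℝ × ℝ) : (boundaryCover p).2.re = Real.cos (2 * Real.pi * p.2) := by
  rw [boundaryCover_snd, ← Complex.mk_eq_add_mul_I]

lemma boundaryCover_im (p : ℝ × ℝ) : (boundaryCover p).2.im = Real.sin (2 * Real.pi * p.2) := by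
  rw [boundaryCover_snd, ← Complex.mk_eq_add_mul_I]

/-- The differential of `boundaryCover` at `p`, applied to `v`. -/
def boundaryTangent (p v : ℝ × ℝ) : ℝ × ℂ :=
  (v.1, (2 * Real.pi * v.2 : ℝ) * ((-Real.sin (2 * Real.pi * p.2) : ℝ) +
    (Real.cos (2 * Real.pi * p.2) : ℝ) * Complex.I))

lemma boundaryTangent_re (p v : ℝ × ℝ) : (boundaryTangent p v).2.re =
    -(2 * Real.pi * v.2 * Real.sin (2 * Real.pi * p.2)) := by
  rw [boundaryTangent, Complex.re_ofReal_mul, ← Complex.mk_eq_add_mul_I]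
  ring

lemma boundaryTangent_im (p v : ℝ × ℝ) : (boundaryTangent p v).2.im =
    2 * Real.pi * v.2 * Real.cos (2 * Real.pi * p.2) := by
  rw [boundaryTangent, Complex.im_ofReal_mul, ← Complex.mk_eq_add_mul_I]

lemma hasFDerivAt_boundaryCover (p : ℝ × ℝ) : ∃ B : ℝ × ℝ →L[ℝ] ℝ × ℂ,
    HasFDerivAt boundaryCover B p ∧ ∀ v, B v = boundaryTangent p v := by
  have h1 := Complex.ofRealCLM.hasFDerivAt.comp p
    ((ContinuousLinearMap.snd ℝ ℝ ℝ).hasFDerivAt (x := p))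
  have h2 := ((h1.const_mul (2 * Real.pi : ℂ)).mul_const Complex.I).cexp
  refine ⟨_, ((ContinuousLinearMap.fst ℝ ℝ ℝ).hasFDerivAt (x := p)).prodMk h2, fun v => ?_⟩
  refine Prod.ext rfl ?_
  have h3 := boundaryCover_snd p
  rw [boundaryCover] at h3
  simp only [boundaryTangent]
  simp
  simp at h3
  rw [h3]
  linear_combination (2 * Real.pi * v.2 * Complex.sin (2 * Real.pi * p.2) ) * Complex.I_sq

lemma contDiff_boundaryCover : ContDiff ℝ ∞ boundaryCover := by
  have h1 : ContDiff ℝ ∞ fun p : ℝ × ℝ => (p.2 : ℂ) := Complex.ofRealCLM.contDiff.comp contDiff_snd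
  exact contDiff_fst.prodMk ((contDiff_const.mul h1).mul contDiff_const).cexp

lemma fderiv_torus (hg : IsProfile g) (p v : ℝ × ℝ) : fderiv ℝ (D.torus g) p v =
    fderiv ℝ (D.solid g) (boundaryCover p) (boundaryTangent p v) := by
  obtain ⟨B, hB, hB'⟩ := hasFDerivAt_boundaryCover p
  have h1 := (((D.contDiff_solid hg).differentiable (by simp)).differentiableAt
    (x := boundaryCover p)).hasFDerivAt.comp p hB
  have h2 : fderiv ℝ (D.torus g) p = _ := h1.fderiv
  rw [h2, ContinuousLinearMap.comp_apply, hB']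

lemma isLagrangian (hg : IsProfile g) : IsLagrangian (D.torus g) := by
  intro p u v
  rw [fderiv_torus D hg, fderiv_torus D hg, omega_fderiv_solid D hg]
  simp only [boundaryTangent_re, boundaryTangent_im]
  ring

lemma isEmbeddedTorus (hg : IsProfile g) : IsEmbeddedTorus (D.torus g) where
  smooth := (D.contDiff_solid hg).comp contDiff_boundaryCover
  eq_iff p q := by
    rw [torus, torus, solid_eq_iff D hg]
    have h1 : (boundaryCover q).2 = (boundaryCover p).2 ↔ ∃ l : ℤ, q.2 = p.2 + l := by
      rw [boundaryCover, boundaryCover, Complex.exp_eq_exp_iff_exists_int]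
      have hpi : (Real.pi : ℂ) ≠ 0 := by exact_mod_cast Real.pi_ne_zero
      refine exists_congr fun l => ?_
      constructor
      · intro hl
        have h2 : ((q.2 : ℝ) : ℂ) = ((p.2 + l : ℝ) : ℂ) := by
          apply mul_left_cancel₀ (mul_ne_zero two_ne_zero hpi)
          apply mul_right_cancel₀ Complex.I_ne_zero
          rw [hl]
          push_cast
          ring
        exact Complex.ofReal_injective h2
      · intro hl
        rw [hl]
        push_cast
        ring
    rw [h1]
    constructor
    · rintro ⟨⟨k, hk⟩, l, hl⟩
      exact ⟨k, l, Prod.ext hk hl⟩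
    · rintro ⟨k, l, rfl⟩
      exact ⟨⟨k, rfl⟩, l, rfl⟩
  immersion p := by
    rw [injective_iff_map_eq_zero]
    intro v hv
    rw [fderiv_torus D hg] at hv
    have h1 := (injective_iff_map_eq_zero _).1 (D.fderiv_solid_injective hg _) _ hv
    have h2 : v.1 = 0 := congrArg Prod.fst h1
    have h3 := congrArg (fun x : ℝ × ℂ => x.2.re) h1
    have h4 := congrArg (fun x : ℝ × ℂ => x.2.im) h1
    simp only [boundaryTangent_re, boundaryTangent_im, Prod.snd_zero, Complex.zero_re,
      Complex.zero_im] at h3 h4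
    have h5 := Real.sin_sq_add_cos_sq (2 * Real.pi * p.2)
    have hpi := Real.pi_pos
    have h6 : 2 * Real.pi * v.2 = 0 := by
      linear_combination (-Real.sin (2 * Real.pi * p.2)) * h3 +
        Real.cos (2 * Real.pi * p.2) * h4 - 2 * Real.pi * v.2 * h5
    refine Prod.ext h2 ?_
    simpa [hpi.ne'] using h6

end Steering

namespace Steering

variable {h : ℝ} (D : Steering h) {g : ℝ → ℝ}

/-! ### The area class -/

/-- A function whose derivative is periodic is additive under the period. -/
lemma add_int_of_hasDerivAt_periodic {A a : ℝ → ℝ} (hA : ∀ s, HasDerivAt A (a s) s)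
    (ha : ∀ s, a (s + 1) = a s) (s : ℝ) (n : ℤ) : A (s + n) = A s + n * (A 1 - A 0) := by
  have h1 : ∀ s, A (s + 1) - A s = A 1 - A 0 := by
    have hd : ∀ s, HasDerivAt (fun s => A (s + 1) - A s) 0 s := fun s => by
      have := ((hA (s + 1)).comp_add_const s 1).sub (hA s)
      rwa [ha, sub_self] at this
    intro s
    have := is_const_of_deriv_eq_zero (fun s => (hd s).differentiableAt) (fun s => (hd s).deriv) s 0
    simpa using this
  have h2 : Function.Periodic (fun s => A s - s * (A 1 - A 0)) 1 := fun s => by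
    simp only
    linarith [h1 s]
  have h3 := h2.int_mul n s
  simp only [mul_one] at h3
  linarith

/-- The area class of the torus, in terms of primitives of the restrictions of the Liouville form
to the two circle factors. -/
lemma areaClassEq (hg : IsProfile g) {A B : ℝ → ℝ}
    (hA : ∀ s, HasDerivAt A (D.r s * deriv D.θ s + 2 * h * deriv D.ρ s) s)
    (hB : ∀ t, HasDerivAt B (h * (1 + g (Real.cos (2 * Real.pi * t))) *
      (deriv g (Real.sin (2 * Real.pi * t)) *
        (2 * Real.pi * Real.cos (2 * Real.pi * t)) / 4)) t) (e : ℤ × ℤ) :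
    AreaClassEq (D.torus g) e (e.1 * (A 1 - A 0) + e.2 * (B 1 - B 0)) := by
  intro γ hγ
  have hγd : ∀ t, HasDerivAt γ (deriv γ t) t := fun t =>
    (hγ.1.differentiable (by simp)).differentiableAt.hasDerivAt
  have hγ1 : ∀ t, HasDerivAt (fun t => (γ t).1) (deriv γ t).1 t := fun t => (hγd t).fst
  have hγ2 : ∀ t, HasDerivAt (fun t => (γ t).2) (deriv γ t).2 t := fun t => (hγd t).snd
  have hF := D.isEmbeddedTorus hg
  have hderiv : ∀ t, deriv (D.torus g ∘ γ) t = fderiv ℝ (D.torus g) (γ t) (deriv γ t) := fun t =>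
    ((hF.smooth.differentiable (by simp)).differentiableAt.hasFDerivAt.comp_hasDerivAt t
      (hγd t)).deriv
  have hint : ∀ t, HasDerivAt (fun t => A (γ t).1 + B (γ t).2)
      ((1 / 2 : ℝ) * omega ((D.torus g ∘ γ) t) (deriv (D.torus g ∘ γ) t)) t := by
    intro t
    have h1 := ((hA _).comp t (hγ1 t)).add ((hB _).comp t (hγ2 t))
    refine h1.congr_deriv ?_
    rw [hderiv, fderiv_torus D hg, fderiv_solid D hg]
    refine Eq.symm ((half_omega_polar_radial (D.radius_pos hg _ _) (D.action_pos hg _)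
      _ _ _ _ _ _).trans ?_)
    rw [boundaryTangent_im, boundaryCover_re, boundaryCover_im, radius]
    simp only [boundaryTangent, boundaryCover, D.deriv_ρ]
    ring
  have hcont : Continuous fun t =>
      (1 / 2 : ℝ) * omega ((D.torus g ∘ γ) t) (deriv (D.torus g ∘ γ) t) := by
    have h1 : ContDiff ℝ ∞ (D.torus g ∘ γ) := hF.smooth.comp hγ.1
    have h2 : Continuous (D.torus g ∘ γ) := h1.continuous
    have h3 : Continuous (deriv (D.torus g ∘ γ)) := h1.continuous_deriv (by simp)
    generalize D.torus g ∘ γ = c at h2 h3 ⊢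
    generalize deriv c = c' at h3 ⊢
    unfold omega
    fun_prop
  rw [liouvilleIntegral, intervalIntegral.integral_eq_sub_of_hasDerivAt (fun t _ => hint t)
    (hcont.intervalIntegrable _ _)]
  have h1 := hγ.2 0
  rw [zero_add] at h1
  rw [h1, Prod.fst_add, Prod.snd_add]
  rw [add_int_of_hasDerivAt_periodic hA ?_, add_int_of_hasDerivAt_periodic hB ?_]
  · ring
  · intro t
    rw [show 2 * Real.pi * (t + 1) = 2 * Real.pi * t + 2 * Real.pi by ring, Real.cos_add_two_pi,
      Real.sin_add_two_pi]
  · intro s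
    rw [D.deriv_ρ, D.deriv_ρ, D.r_add_one, D.l_add_one, D.deriv_θ, D.deriv_θ, mul_add, mul_one,
      Real.sin_add_two_pi]

/-! ### Linking with the coordinate axes -/

lemma torus_add_int (hg : IsProfile g) (p : ℝ × ℝ) (k l : ℤ) :
    D.torus g (p + ((k : ℝ), (l : ℝ))) = D.torus g p :=
  (((D.isEmbeddedTorus hg).eq_iff p _).2 ⟨k, l, rfl⟩).symm

lemma torus_fst (p : ℝ × ℝ) : (D.torus g p).1 =
    polar (D.radius p.1 (g (Real.cos (2 * Real.pi * p.2)))) (D.θ p.1) := by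
  rw [torus, solid, boundaryCover_re]
  rfl

lemma torus_snd (p : ℝ × ℝ) : (D.torus g p).2 =
    polar (h * (1 + g (Real.cos (2 * Real.pi * p.2))))
      (g (Real.sin (2 * Real.pi * p.2)) / 4 + D.ρ p.1) := by
  rw [torus, solid, boundaryCover_re, boundaryCover_im]
  rfl

lemma hasArgument_torus_fst (hg : IsProfile g) :
    HasArgument (fun p => (D.torus g p).1) 0 0 := by
  refine .of_polar (R := fun p => √(D.radius p.1 (g (Real.cos (2 * Real.pi * p.2))) / Real.pi))
    (A := fun p => 2 * Real.pi * D.θ p.1) (fun p => ?_) ?_ (fun p => by rw [torus_fst, polar])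
    fun p k l => ?_
  · have := D.radius_pos hg p.1 (Real.cos (2 * Real.pi * p.2))
    positivity
  · have := D.θ_smooth.continuous
    fun_prop
  · simp only [Prod.fst_add, θ_add_int]
    simp

lemma hasArgument_torus_snd (hg : IsProfile g) :
    HasArgument (fun p => (D.torus g p).2) (-1) 0 := by
  refine .of_polar (R := fun p => √(h * (1 + g (Real.cos (2 * Real.pi * p.2))) / Real.pi))
    (A := fun p => 2 * Real.pi * (g (Real.sin (2 * Real.pi * p.2)) / 4 + D.ρ p.1)) (fun p => ?_) ?_
    (fun p => by rw [torus_snd, polar]) fun p k l => ?_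
  · have := D.action_pos hg (Real.cos (2 * Real.pi * p.2))
    positivity
  · have := D.ρ_smooth.continuous
    have := hg.smooth.continuous
    fun_prop
  · simp only [Prod.fst_add, Prod.snd_add, ρ_add_int]
    rw [show 2 * Real.pi * (p.2 + l) = 2 * Real.pi * p.2 + l * (2 * Real.pi) by ring,
      Real.sin_add_int_mul_two_pi]
    push_cast
    ring

lemma linkingWEq (hg : IsProfile g) (e : ℤ × ℤ) : LinkingWEq (D.torus g) e 0 (-e.1) := by
  intro γ hγ
  have h1 := (D.hasArgument_torus_snd hg).hasWindingNumber hγ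
  simpa using h1

/-! ### The Maslov class -/

lemma div_mem_slitPlane {x y : ℂ} (hy : y ≠ 0)
    (h : 0 < x.re * y.re + x.im * y.im ∨ x.im * y.re - x.re * y.im ≠ 0) :
    x / y ∈ Complex.slitPlane := by
  have hn : 0 < Complex.normSq y := Complex.normSq_pos.2 hy
  rw [Complex.mem_slitPlane_iff, Complex.div_re, Complex.div_im, ← add_div, ← sub_div]
  exact h.imp (fun h => div_pos h hn) fun h => div_ne_zero h hn.ne'

/-- The quotient of the perturbation `(a + ib)(c + id) + iκbc`, `κ ≥ 0`, of the product
`(a + ib)(c + id)` by this product is never zero or a negative real number. -/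
lemma perturbed_product_div_mem_slitPlane {a b c d κ : ℝ} (hκ : 0 ≤ κ)
    (hab : (a : ℂ) + b * Complex.I ≠ 0) (hcd : (c : ℂ) + d * Complex.I ≠ 0) :
    (((a : ℂ) + b * Complex.I) * (c + d * Complex.I) + (κ * b * c : ℝ) * Complex.I) /
      (((a : ℂ) + b * Complex.I) * (c + d * Complex.I)) ∈ Complex.slitPlane := by
  have hne := mul_ne_zero hab hcd
  have hN : ((a : ℂ) + b * Complex.I) * (c + d * Complex.I) = ⟨a * c - b * d, a * d + b * c⟩ := by
    apply Complex.ext <;> simp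
  have hN' : ((a : ℂ) + b * Complex.I) * (c + d * Complex.I) + (κ * b * c : ℝ) * Complex.I =
      ⟨a * c - b * d, a * d + b * c + κ * b * c⟩ := by
    rw [hN]
    apply Complex.ext <;> simp
  rw [hN] at hne
  rw [hN', hN]
  refine div_mem_slitPlane hne ?_
  have hpos : 0 < (a * c - b * d) ^ 2 + (a * d + b * c) ^ 2 := by
    have := Complex.normSq_pos.2 hne
    rw [Complex.normSq_mk] at this
    linarith [this]
  simp only
  by_cases h0 : κ * b * c = 0
  · left
    rw [h0]
    linarith
  by_cases hX : a * c - b * d = 0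
  · left
    have h1 : κ * b * c * (a * d + b * c) = κ * ((a * c) ^ 2 + (b * c) ^ 2) := by
      linear_combination (-κ * a * c) * hX
    have h2 : 0 ≤ κ * ((a * c) ^ 2 + (b * c) ^ 2) := by positivity
    linarith
  · right
    intro h1
    have h2 : κ * b * c * (a * c - b * d) = 0 := by linarith
    exact (mul_ne_zero h0 hX) h2

/-- The direction of the closed curve followed by the disc in the first factor makes one turn in
the negative sense. -/
lemma hasArgument_motion (hg : IsProfile g) : HasArgument (fun p : ℝ × ℝ =>
    ((D.radiusDeriv g (boundaryCover p) (1, 0) /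
      (2 * D.radius p.1 (g (Real.cos (2 * Real.pi * p.2)))) : ℝ) : ℂ) +
      (2 * Real.pi * deriv D.θ p.1 : ℝ) * Complex.I) (-1) 0 := by
  have hpi := Real.pi_pos
  have href : HasArgument (fun p : ℝ × ℝ => ((-Real.cos (2 * Real.pi * p.1) : ℝ) : ℂ) +
      (Real.sin (2 * Real.pi * p.1) : ℝ) * Complex.I) (-1) 0 := by
    refine .of_polar (R := fun _ => 1) (A := fun p => Real.pi - 2 * Real.pi * p.1)
      (fun _ => one_pos) (by fun_prop) (fun p => ?_) fun p k l => ?_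
    · rw [Complex.exp_mul_I, ← Complex.ofReal_cos, ← Complex.ofReal_sin, Real.cos_pi_sub,
        Real.sin_pi_sub, Complex.ofReal_one, one_mul]
    · simp only [Prod.fst_add]
      push_cast
      ring
  have hper : ∀ (x : ℝ) (k : ℤ), 2 * Real.pi * (x + k) = 2 * Real.pi * x + k * (2 * Real.pi) :=
    fun x k => by ring
  have hR : Continuous fun p : ℝ × ℝ => D.radius p.1 (g (Real.cos (2 * Real.pi * p.2))) := by
    have := hg.smooth.continuous
    have := D.r_smooth.continuous
    have := D.l_smooth.continuous
    unfold radius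
    fun_prop
  have h1 : ∀ p : ℝ × ℝ, D.radiusDeriv g (boundaryCover p) (1, 0) =
      deriv D.r p.1 - deriv D.l p.1 * (h * (1 - g (Real.cos (2 * Real.pi * p.2)))) := fun p => by
    rw [radiusDeriv, boundaryCover_re]
    simp [boundaryCover]
  have hdr : ∀ {f : ℝ → ℝ}, (∀ s, f (s + 1) = f s) → ∀ (s : ℝ) (k : ℤ),
      deriv f (s + k) = deriv f s := fun {f} hf s k => by
    have h2 := (show Function.Periodic f 1 from hf).int_mul k
    rw [mul_one] at h2
    rw [← deriv_comp_add_const]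
    congr 1
    exact funext h2
  refine href.of_div_slitPlane ?_ (by fun_prop) (fun p => ?_) (fun p k l => ?_) fun p k l => ?_
  · simp only [h1]
    have := hg.smooth.continuous
    have h3 := D.r_smooth.continuous_deriv (by simp)
    have h4 := D.l_smooth.continuous_deriv (by simp)
    have h5 := D.θ_smooth.continuous_deriv (by simp)
    have h6 : ∀ p : ℝ × ℝ, 2 * D.radius p.1 (g (Real.cos (2 * Real.pi * p.2))) ≠ 0 := fun p =>
      (mul_pos two_pos (D.radius_pos hg _ _)).ne'
    refine (Complex.continuous_ofReal.comp (Continuous.div ?_ (by fun_prop) h6)).add ?_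
    · fun_prop
    · fun_prop
  · rw [← Complex.mk_eq_add_mul_I, ← Complex.mk_eq_add_mul_I]
    have hsc := Real.sin_sq_add_cos_sq (2 * Real.pi * p.1)
    have hRp := D.radius_pos hg p.1 (Real.cos (2 * Real.pi * p.2))
    refine div_mem_slitPlane (fun h0 => ?_) ?_
    · have h2 := congrArg Complex.re h0
      have h3 := congrArg Complex.im h0
      simp only [Complex.zero_re, Complex.zero_im] at h2 h3
      rw [neg_eq_zero] at h2
      rw [h2, h3] at hsc
      norm_num at hsc
    · simp only
      rw [h1, D.deriv_θ]
      by_cases hs : Real.sin (2 * Real.pi * p.1) = 0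
      · left
        obtain ⟨-, hl, hr⟩ := D.turn p.1 hs
        rw [hs, hl, mul_zero, add_zero, zero_mul, sub_zero, mul_neg, neg_pos, div_mul_eq_mul_div]
        exact div_neg_of_neg_of_pos hr (by linarith)
      · generalize (deriv D.r p.1 - deriv D.l p.1 * (h * (1 - g (Real.cos (2 * Real.pi * p.2))))) /
          (2 * D.radius p.1 (g (Real.cos (2 * Real.pi * p.2)))) = a
        generalize Real.sin (2 * Real.pi * p.1) = S at hs hsc ⊢
        generalize Real.cos (2 * Real.pi * p.1) = C at hsc ⊢
        have hβ : 0 < 2 * Real.pi * D.speed := by have := D.speed_pos; positivity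
        by_cases ha : a = -(2 * Real.pi * D.speed * C)
        · left
          rw [ha]
          have : 2 * Real.pi * D.speed * (S ^ 2 + C ^ 2) = 2 * Real.pi * D.speed := by
            rw [hsc, mul_one]
          linarith
        · right
          intro h2
          have h3 : S * (a + 2 * Real.pi * D.speed * C) = 0 := by linarith
          rcases mul_eq_zero.1 h3 with h4 | h4
          · exact hs h4
          · exact ha (by linarith)
  · simp only [h1, Prod.fst_add, Prod.snd_add, radius_add_int, hdr D.r_add_one, hdr D.l_add_one,
      hdr D.θ_add_one, hper, Real.cos_add_int_mul_two_pi]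
  · simp only [Prod.fst_add, hper, Real.cos_add_int_mul_two_pi, Real.sin_add_int_mul_two_pi]

/-- The direction of the boundary of the disc in the second factor makes one turn in the positive
sense. -/
lemma hasArgument_boundary (D : Steering h) (hg : IsProfile g) : HasArgument (fun p : ℝ × ℝ =>
    ((h * (deriv g (Real.cos (2 * Real.pi * p.2)) *
      -(2 * Real.pi * Real.sin (2 * Real.pi * p.2))) /
        (2 * (h * (1 + g (Real.cos (2 * Real.pi * p.2))))) : ℝ) : ℂ) +
      (2 * Real.pi * (deriv g (Real.sin (2 * Real.pi * p.2)) *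
        (2 * Real.pi * Real.cos (2 * Real.pi * p.2)) / 4) : ℝ) * Complex.I) 0 1 := by
  have hpi := Real.pi_pos
  have hh := D.h_pos
  have href : HasArgument (fun p : ℝ × ℝ => ((-Real.sin (2 * Real.pi * p.2) : ℝ) : ℂ) +
      (Real.cos (2 * Real.pi * p.2) : ℝ) * Complex.I) 0 1 := by
    refine .of_polar (R := fun _ => 1) (A := fun p => 2 * Real.pi * p.2 + Real.pi / 2)
      (fun _ => one_pos) (by fun_prop) (fun p => ?_) fun p k l => ?_
    · rw [Complex.exp_mul_I, ← Complex.ofReal_cos, ← Complex.ofReal_sin, Real.cos_add_pi_div_two,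
        Real.sin_add_pi_div_two, Complex.ofReal_one, one_mul]
    · simp only [Prod.snd_add]
      push_cast
      ring
  have hper : ∀ (x : ℝ) (k : ℤ), 2 * Real.pi * (x + k) = 2 * Real.pi * x + k * (2 * Real.pi) :=
    fun x k => by ring
  refine href.of_div_slitPlane ?_ (by fun_prop) (fun p => ?_) (fun p k l => ?_) fun p k l => ?_
  · have h3 := hg.smooth.continuous
    have h4 := hg.smooth.continuous_deriv (by simp)
    have h6 : ∀ p : ℝ × ℝ, 2 * (h * (1 + g (Real.cos (2 * Real.pi * p.2)))) ≠ 0 := fun p =>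
      (mul_pos two_pos (D.action_pos hg _)).ne'
    refine (Complex.continuous_ofReal.comp (Continuous.div ?_ (by fun_prop) h6)).add ?_
    · fun_prop
    · fun_prop
  · rw [← Complex.mk_eq_add_mul_I, ← Complex.mk_eq_add_mul_I]
    have hsc := Real.sin_sq_add_cos_sq (2 * Real.pi * p.2)
    have hU := D.action_pos hg (Real.cos (2 * Real.pi * p.2))
    have hc := hg.deriv_pos (Real.cos (2 * Real.pi * p.2))
    have hs := hg.deriv_pos (Real.sin (2 * Real.pi * p.2))
    refine div_mem_slitPlane (fun h0 => ?_) (Or.inl ?_)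
    · have h2 := congrArg Complex.re h0
      have h3 := congrArg Complex.im h0
      simp only [Complex.zero_re, Complex.zero_im] at h2 h3
      rw [neg_eq_zero] at h2
      rw [h2, h3] at hsc
      norm_num at hsc
    · simp only
      generalize h * (1 + g (Real.cos (2 * Real.pi * p.2))) = U at hU ⊢
      generalize deriv g (Real.cos (2 * Real.pi * p.2)) = α at hc ⊢
      generalize deriv g (Real.sin (2 * Real.pi * p.2)) = β at hs ⊢
      generalize Real.sin (2 * Real.pi * p.2) = S at hsc ⊢
      generalize Real.cos (2 * Real.pi * p.2) = C at hsc ⊢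
      have h1 : h * (α * -(2 * Real.pi * S)) / (2 * U) * -S +
          2 * Real.pi * (β * (2 * Real.pi * C) / 4) * C =
          (h * α * Real.pi / U) * S ^ 2 + (Real.pi ^ 2 * β) * C ^ 2 := by
        field_simp
        ring
      rw [h1]
      have h2 : 0 < h * α * Real.pi / U := by positivity
      have h3 : 0 < Real.pi ^ 2 * β := by positivity
      rcases eq_or_ne S 0 with h4 | h4
      · rw [h4] at hsc ⊢
        have : C ^ 2 = 1 := by linarith
        rw [this]
        linarith
      · have := mul_pos h2 (sq_pos_of_ne_zero h4)
        have := mul_nonneg h3.le (sq_nonneg C)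
        linarith
  · simp only [Prod.snd_add, hper, Real.cos_add_int_mul_two_pi, Real.sin_add_int_mul_two_pi]
  · simp only [Prod.snd_add, hper, Real.cos_add_int_mul_two_pi, Real.sin_add_int_mul_two_pi]

/-- The frame `∂/∂s`, `∂/∂t` of the torus has a complex determinant whose argument decreases by
two full turns along the first period and increases by one full turn along the second. Up to a
factor in the slit plane, it is the product of the two coordinates, of the direction of the motion
in the first factor and of the direction of the boundary of the disc in the second. -/
lemma hasArgument_det (hg : IsProfile g) : HasArgument (fun p =>
    (fderiv ℝ (D.torus g) p (1, 0)).1 * (fderiv ℝ (D.torus g) p (0, 1)).2 -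
      (fderiv ℝ (D.torus g) p (1, 0)).2 * (fderiv ℝ (D.torus g) p (0, 1)).1) (-2) 1 := by
  have hM := D.hasArgument_motion hg
  have hB := D.hasArgument_boundary hg
  have hprod := ((D.hasArgument_torus_fst hg).mul (D.hasArgument_torus_snd hg)).mul (hM.mul hB)
  have hsm := (D.isEmbeddedTorus hg).smooth
  have hcont : ∀ v, Continuous fun p => fderiv ℝ (D.torus g) p v := fun v =>
    (hsm.continuous_fderiv (by simp)).clm_apply continuous_const
  have hper : ∀ (v p : ℝ × ℝ) (k l : ℤ), fderiv ℝ (D.torus g) (p + ((k : ℝ), (l : ℝ))) v =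
      fderiv ℝ (D.torus g) p v := fun v p k l => by
    rw [← fderiv_comp_add_right]
    congr 2
    exact funext fun q => D.torus_add_int hg q k l
  have hs : ∀ p, fderiv ℝ (D.torus g) p (1, 0) =
      ((D.torus g p).1 * (((D.radiusDeriv g (boundaryCover p) (1, 0) /
          (2 * D.radius p.1 (g (Real.cos (2 * Real.pi * p.2)))) : ℝ) : ℂ) +
          (2 * Real.pi * deriv D.θ p.1 : ℝ) * Complex.I),
        (D.torus g p).2 * ((2 * Real.pi * deriv D.ρ p.1 : ℝ) * Complex.I)) := fun p => by
    have h1 : boundaryTangent p (1, 0) = (1, 0) := by simp [boundaryTangent]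
    rw [fderiv_torus D hg, h1, fderiv_solid D hg, boundaryCover_re]
    simp [torus, boundaryCover]
  have ht : ∀ p, fderiv ℝ (D.torus g) p (0, 1) =
      ((D.torus g p).1 * ((D.l p.1 * (h * (deriv g (Real.cos (2 * Real.pi * p.2)) *
          -(2 * Real.pi * Real.sin (2 * Real.pi * p.2)))) /
          (2 * D.radius p.1 (g (Real.cos (2 * Real.pi * p.2)))) : ℝ) : ℂ),
        (D.torus g p).2 * (((h * (deriv g (Real.cos (2 * Real.pi * p.2)) *
          -(2 * Real.pi * Real.sin (2 * Real.pi * p.2))) /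
            (2 * (h * (1 + g (Real.cos (2 * Real.pi * p.2))))) : ℝ) : ℂ) +
          (2 * Real.pi * (deriv g (Real.sin (2 * Real.pi * p.2)) *
            (2 * Real.pi * Real.cos (2 * Real.pi * p.2)) / 4) : ℝ) * Complex.I)) := fun p => by
    have h1 : (boundaryTangent p (0, 1)).1 = 0 := rfl
    rw [fderiv_torus D hg, fderiv_solid D hg, radiusDeriv, h1, boundaryTangent_re,
      boundaryTangent_im, boundaryCover_re, boundaryCover_im]
    simp only [mul_zero, zero_add, add_zero, mul_one, Complex.ofReal_zero, zero_mul]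
    rfl
  have hg0 : HasArgument (fun p =>
      (fderiv ℝ (D.torus g) p (1, 0)).1 * (fderiv ℝ (D.torus g) p (0, 1)).2) (-2) 1 := by
    refine HasArgument.congr (m := 0 + -1 + (-1 + 0)) (n := 0 + 0 + (0 + 1)) hprod fun p => ?_
    rw [hs, ht]
    ring
  refine hg0.of_div_slitPlane ?_ ?_ (fun p => ?_) (fun p k l => ?_) fun p k l => ?_
  · have := hcont (1, 0)
    have := hcont (0, 1)
    fun_prop
  · have := hcont (1, 0)
    have := hcont (0, 1)
    fun_prop
  · have hz : (D.torus g p).1 ≠ 0 := ((D.hasArgument_torus_fst hg).choose_spec.2.1 p).1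
    have hw : (D.torus g p).2 ≠ 0 := ((D.hasArgument_torus_snd hg).choose_spec.2.1 p).1
    have hP := (hM.choose_spec.2.1 p).1
    have hQ := (hB.choose_spec.2.1 p).1
    have hR := D.radius_pos hg p.1 (Real.cos (2 * Real.pi * p.2))
    have hU := D.action_pos hg (Real.cos (2 * Real.pi * p.2))
    have hκ : 0 ≤ D.l p.1 ^ 2 * (h * (1 + g (Real.cos (2 * Real.pi * p.2)))) /
        D.radius p.1 (g (Real.cos (2 * Real.pi * p.2))) := by positivity
    have key := perturbed_product_div_mem_slitPlane hκ hP hQ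
    rw [← mul_div_mul_left _ _ (mul_ne_zero hz hw)] at key
    have hreal : D.l p.1 ^ 2 * (h * (1 + g (Real.cos (2 * Real.pi * p.2)))) /
          D.radius p.1 (g (Real.cos (2 * Real.pi * p.2))) * (2 * Real.pi * deriv D.θ p.1) *
          (h * (deriv g (Real.cos (2 * Real.pi * p.2)) *
            -(2 * Real.pi * Real.sin (2 * Real.pi * p.2))) /
              (2 * (h * (1 + g (Real.cos (2 * Real.pi * p.2)))))) =
        -(2 * Real.pi * deriv D.ρ p.1 * (D.l p.1 * (h * (deriv g (Real.cos (2 * Real.pi * p.2)) *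
          -(2 * Real.pi * Real.sin (2 * Real.pi * p.2)))) /
          (2 * D.radius p.1 (g (Real.cos (2 * Real.pi * p.2)))))) := by
      rw [D.deriv_ρ]
      generalize h * (1 + g (Real.cos (2 * Real.pi * p.2))) = U at hU ⊢
      field_simp
    rw [hreal] at key
    convert key using 2
    · rw [hs, ht]
      simp only [Complex.ofReal_neg, Complex.ofReal_mul]
      ring
    · rw [hs, ht]
      ring
  · simp only [hper]
  · simp only [hper]

lemma maslovClassEq (hg : IsProfile g) (e : ℤ × ℤ) :
    MaslovClassEq (D.torus g) e (-4 * e.1 + 2 * e.2) := by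
  intro γ hγ
  have hsm := (D.isEmbeddedTorus hg).smooth
  have hcont : ∀ v, Continuous fun t => fderiv ℝ (D.torus g) (γ t) v := fun v =>
    ((hsm.continuous_fderiv (by simp)).comp hγ.1.continuous).clm_apply continuous_const
  refine ⟨fun t => fderiv ℝ (D.torus g) (γ t) (1, 0), fun t => fderiv ℝ (D.torus g) (γ t) (0, 1),
    hcont _, hcont _, fun t => ⟨?_, ?_⟩, ?_⟩
  · rw [LinearIndependent.pair_iff]
    intro a b hab
    rw [← map_smul, ← map_smul, ← map_add] at hab
    have h1 := (injective_iff_map_eq_zero _).1 ((D.isEmbeddedTorus hg).immersion (γ t)) _ hab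
    simpa using h1
  · ext y
    rw [LinearMap.mem_range, Submodule.mem_span_pair]
    constructor
    · rintro ⟨v, rfl⟩
      refine ⟨v.1, v.2, ?_⟩
      rw [← map_smul, ← map_smul, ← map_add]
      simp
    · rintro ⟨a, b, rfl⟩
      refine ⟨(a, b), ?_⟩
      rw [← map_smul, ← map_smul, ← map_add]
      simp
  · have h1 := ((D.hasArgument_det hg).mul (D.hasArgument_det hg)).hasWindingNumber hγ
    have h2 : e.1 * (-2 + -2) + e.2 * (1 + 1) = -4 * e.1 + 2 * e.2 := by ring
    rw [h2] at h1
    simpa only [sq] using h1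

end Steering

/-! ### Linking with a line parallel to the second axis -/

lemma mul_polar {x : ℝ} (hx : 0 ≤ x) (r θ : ℝ) : (x : ℂ) * polar r θ = polar (x ^ 2 * r) θ := by
  rw [polar, polar, mul_div_assoc, Real.sqrt_mul (sq_nonneg x), Real.sqrt_sq hx]
  push_cast
  ring

lemma polar_div_polar (r r' θ θ' : ℝ) : polar r θ / polar r' θ' =
    (√(r / Real.pi) / √(r' / Real.pi) : ℝ) *
      Complex.exp ((2 * Real.pi * (θ - θ') : ℝ) * Complex.I) := by
  rw [polar, polar, mul_div_mul_comm, ← Complex.exp_sub]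
  push_cast
  congr 2
  ring

namespace Steering

variable {h : ℝ} (D : Steering h) {g : ℝ → ℝ}

/-- Let `a` be a point such that, up to period, the motion hits the segment from `0` to `a` only
once, at the parameter `s₀`, where it crosses the segment in the negative sense with respect to
the origin. Then the motion misses `a`, and it turns once around `a` in the positive sense since
its winding number around the origin vanishes. -/
lemma hasArgument_torus_fst_sub (hg : IsProfile g) {r₀ s₀ : ℝ} (hr₀ : 0 < r₀)
    (hout : ∀ (s v : ℝ) (k : ℤ), s₀ < s → s < s₀ + 1 → 0 < v → v < 2 * h →
      D.θ s = D.θ s₀ + k → r₀ < D.r s - D.l s * v)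
    (hin : D.r s₀ < r₀) (hl : D.l s₀ = 0) (hneg : deriv D.θ s₀ < 0) :
    (∀ q, (D.solid g q).1 ≠ polar r₀ (D.θ s₀)) ∧
      HasArgument (fun p => (D.torus g p).1 - polar r₀ (D.θ s₀)) 1 0 := by
  have hpi := Real.pi_pos
  have hh := D.h_pos
  have hout' : ∀ (s y : ℝ) (k : ℤ), s₀ < s → s < s₀ + 1 → D.θ s = D.θ s₀ + k →
      r₀ < D.radius s (g y) := fun s y k h1 h2 h3 =>
    hout s _ k h1 h2 (mul_pos hh (by linarith [hg.upper y])) (by nlinarith [hg.lower y]) h3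
  have hin' : ∀ y, D.radius s₀ (g y) < r₀ := fun y => by
    rw [radius, hl, zero_mul, sub_zero]
    exact hin
  have hne : ∀ s y : ℝ, polar (D.radius s (g y)) (D.θ s) ≠ polar r₀ (D.θ s₀) := by
    intro s y heq
    obtain ⟨n, hn⟩ : ∃ n : ℤ, s = (s₀ + Int.fract (s - s₀)) + n :=
      ⟨⌊s - s₀⌋, by linarith [Int.floor_add_fract (s - s₀)]⟩
    rw [hn, radius_add_int, θ_add_int] at heq
    obtain ⟨h1, k, hk⟩ := (polar_eq_iff (D.radius_pos hg _ _) hr₀).1 heq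
    rcases (Int.fract_nonneg (s - s₀)).eq_or_lt with h0 | h0
    · rw [← h0, add_zero] at h1
      exact (hin' y).ne h1
    · have h2 := hout' (s₀ + Int.fract (s - s₀)) y (-k) (by linarith)
        (by linarith [Int.fract_lt_one (s - s₀)]) (by push_cast; linarith)
      exact h2.ne' h1
  refine ⟨fun q => hne _ _, ?_⟩
  have hfst := D.hasArgument_torus_fst hg
  have hz : ∀ p, (D.torus g p).1 ≠ 0 := fun p => (hfst.choose_spec.2.1 p).1
  have hcont : Continuous (D.torus g) := (D.isEmbeddedTorus hg).smooth.continuous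
  have him : ∀ p : ℝ × ℝ, ∃ c : ℝ, 0 < c ∧ (1 - polar r₀ (D.θ s₀) / (D.torus g p).1).im =
      c * Real.sin (2 * Real.pi * (D.θ p.1 - D.θ s₀)) := by
    intro p
    have hR := D.radius_pos hg p.1 (Real.cos (2 * Real.pi * p.2))
    refine ⟨√(r₀ / Real.pi) / √(D.radius p.1 (g (Real.cos (2 * Real.pi * p.2))) / Real.pi),
      by positivity, ?_⟩
    rw [torus_fst, polar_div_polar, Complex.sub_im, Complex.im_ofReal_mul,
      Complex.exp_ofReal_mul_I_im, Complex.one_im,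
      show 2 * Real.pi * (D.θ s₀ - D.θ p.1) = -(2 * Real.pi * (D.θ p.1 - D.θ s₀)) by ring,
      Real.sin_neg]
    ring
  have hsmall : ∀ᶠ s in 𝓝 s₀, |D.θ s - D.θ s₀| < 1 / 2 := by
    have h1 := D.θ_smooth.continuous.tendsto s₀
    exact (Metric.tendsto_nhds.1 h1 (1 / 2) (by norm_num))
  have hsign : ∀ᶠ s in 𝓝 s₀, SignType.sign (D.θ s - D.θ s₀) = SignType.sign (s₀ - s) := by
    refine eventually_nhdsWithin_sign_eq_of_deriv_neg (f := fun s => D.θ s - D.θ s₀) ?_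
      (sub_self _)
    rwa [deriv_sub_const]
  have hW : HasArgument (fun p => 1 - polar r₀ (D.θ s₀) / (D.torus g p).1) 1 0 := by
    refine .of_crossing (s₀ := s₀) ?_ (fun p k l => by simp only [D.torus_add_int hg]) ?_ ?_ ?_ ?_
      ?_ ?_
    · exact continuous_const.sub (continuous_const.div hcont.fst hz)
    · intro p h0
      rw [sub_eq_zero, eq_comm, div_eq_one_iff_eq (hz p), torus_fst] at h0
      exact hne _ _ h0.symm
    · intro s t h1 h2
      rw [Complex.mem_slitPlane_iff]
      by_contra! hcon
      obtain ⟨hre, him0⟩ := hcon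
      set q := polar r₀ (D.θ s₀) / (D.torus g (s, t)).1 with hq
      have hq' : q = (q.re : ℂ) := by
        rw [Complex.sub_im, Complex.one_im, zero_sub, neg_eq_zero] at him0
        exact Complex.ext rfl (by simp [him0])
      have hq1 : 1 ≤ q.re := by
        rw [Complex.sub_re, Complex.one_re] at hre
        linarith
      have h3 : polar r₀ (D.θ s₀) = q * (D.torus g (s, t)).1 := (div_mul_cancel₀ _ (hz _)).symm
      have hR := D.radius_pos hg s (Real.cos (2 * Real.pi * t))
      rw [hq', torus_fst, mul_polar (by linarith), polar_eq_iff hr₀ (by positivity)] at h3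
      obtain ⟨h4, k, hk⟩ := h3
      have h5 := hout' s (Real.cos (2 * Real.pi * t)) k h1 h2 hk
      rw [h4] at h5
      exact absurd h5 (not_lt.2 (le_mul_of_one_le_left hR.le (one_le_pow₀ hq1)))
    · obtain ⟨y, hy⟩ : ∃ y, (D.torus g (s₀, 0)).1 = polar (D.radius s₀ (g y)) (D.θ s₀) :=
        ⟨_, D.torus_fst _⟩
      have hR := D.radius_pos hg s₀ y
      have hR' := hin' y
      rw [hy, polar_div_polar, sub_self, mul_zero, Complex.ofReal_zero, zero_mul,
        Complex.exp_zero, mul_one, Complex.sub_re, Complex.ofReal_re, Complex.one_re, sub_neg,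
        one_lt_div (by positivity)]
      exact Real.sqrt_lt_sqrt (by positivity) (by gcongr)
    · obtain ⟨c, -, hc⟩ := him (s₀, 0)
      rw [hc]
      simp
    · filter_upwards [hsmall.filter_mono nhdsWithin_le_nhds,
        hsign.filter_mono nhdsWithin_le_nhds, self_mem_nhdsWithin] with s h1 h2 h3
      obtain ⟨c, hc0, hc⟩ := him (s, 0)
      rw [sign_pos (sub_pos.2 (show s < s₀ from h3)), sign_eq_one_iff] at h2
      rw [hc]
      rw [abs_lt] at h1
      exact mul_pos hc0 (Real.sin_pos_of_pos_of_lt_pi (by positivity) (by nlinarith))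
    · filter_upwards [hsmall.filter_mono nhdsWithin_le_nhds,
        hsign.filter_mono nhdsWithin_le_nhds, self_mem_nhdsWithin] with s h1 h2 h3
      obtain ⟨c, hc0, hc⟩ := him (s, 0)
      rw [sign_neg (sub_neg.2 (show s₀ < s from h3)), sign_eq_neg_one_iff] at h2
      rw [hc]
      rw [abs_lt] at h1
      exact mul_neg_of_pos_of_neg hc0 (Real.sin_neg_of_neg_of_neg_pi_lt (by nlinarith)
        (by nlinarith))
  refine HasArgument.congr (m := 0 + 1) (n := 0 + 0) (hfst.mul hW) fun p => ?_
  rw [mul_sub, mul_one, mul_div_cancel₀ _ (hz p)]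

end Steering

/-! ### Discs of area one inside slightly larger half discs -/

lemma isProfile_arctan {K : ℝ} (hK : 0 < K) :
    IsProfile fun y => 2 / Real.pi * Real.arctan (K * y) := by
  have hpi := Real.pi_pos
  refine ⟨?_, fun y => ?_, fun y => ?_, fun y => ?_⟩
  · exact contDiff_const.mul (Real.contDiff_arctan.comp (contDiff_const.mul contDiff_id))
  · have h1 : HasDerivAt (fun y => 2 / Real.pi * Real.arctan (K * y))
        (2 / Real.pi * (1 / (1 + (K * y) ^ 2) * K)) y := by
      have := ((hasDerivAt_id y).const_mul K).arctan.const_mul (2 / Real.pi)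
      simpa using this
    rw [h1.deriv]
    positivity
  · have := Real.neg_pi_div_two_lt_arctan (K * y)
    rw [div_mul_eq_mul_div, lt_div_iff₀ hpi]
    linarith
  · have := Real.arctan_lt_pi_div_two (K * y)
    rw [div_mul_eq_mul_div, div_lt_one hpi]
    linarith

/-- The images of the unit disc under the square of a steep profile have area close to that of
the square `[-1, 1]²`. Rescaling one of the actions gives area one exactly. -/
lemma exists_profile {ε : ℝ} (hε : 0 < ε) : ∃ (g : ℝ → ℝ) (h : ℝ) (B : ℝ → ℝ), IsProfile g ∧
    1 ≤ h ∧ h < 1 + ε ∧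
    (∀ t, HasDerivAt B (h * (1 + g (Real.cos (2 * Real.pi * t))) *
      (deriv g (Real.sin (2 * Real.pi * t)) *
        (2 * Real.pi * Real.cos (2 * Real.pi * t)) / 4)) t) ∧ B 1 - B 0 = 1 := by
  have hpi := Real.pi_pos
  -- The slope is chosen such that the square of the value at `1 / √2` exceeds `1 / (1 + ε)`.
  obtain ⟨K, hK0, hK⟩ : ∃ K : ℝ, 0 < K ∧
      1 / (1 + ε) < (2 / Real.pi * Real.arctan (K * (√2 / 2))) ^ 2 := by
    have h1 : Filter.Tendsto (fun K : ℝ => (2 / Real.pi * Real.arctan (K * (√2 / 2))) ^ 2)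
        Filter.atTop (𝓝 ((2 / Real.pi * (Real.pi / 2)) ^ 2)) := by
      refine (Filter.Tendsto.const_mul _ ?_).pow 2
      exact (Real.tendsto_arctan_atTop.mono_right nhdsWithin_le_nhds).comp
        (Filter.tendsto_id.atTop_mul_const (by positivity))
    have h2 : 1 / (1 + ε) < (2 / Real.pi * (Real.pi / 2)) ^ 2 := by
      rw [show 2 / Real.pi * (Real.pi / 2) = 1 by field_simp, one_pow, div_lt_one (by linarith)]
      linarith
    exact ((Filter.eventually_gt_atTop 0).and (h1.eventually_const_lt h2)).exists
  set g : ℝ → ℝ := fun y => 2 / Real.pi * Real.arctan (K * y) with hg_def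
  have hg : IsProfile g := isProfile_arctan hK0
  have hgodd : ∀ y, g (-y) = -g y := fun y => by
    simp [hg_def, Real.arctan_neg]
  have hg0 : g 0 = 0 := by simp [hg_def]
  have hgd : ∀ y, HasDerivAt g (deriv g y) y := fun y =>
    (hg.smooth.differentiable (by simp)).differentiableAt.hasDerivAt
  have hdeven : ∀ y, deriv g (-y) = deriv g y := fun y => by
    have h1 : (fun y => g (-y)) = fun y => -g y := funext hgodd
    have h2 : deriv (fun y => g (-y)) y = -deriv g y := by rw [h1, deriv.fun_neg]
    rw [deriv_comp_neg] at h2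
    linarith
  have hS : ∀ t, HasDerivAt (fun t => g (Real.sin (2 * Real.pi * t)))
      (deriv g (Real.sin (2 * Real.pi * t)) * (2 * Real.pi * Real.cos (2 * Real.pi * t))) t := by
    intro t
    have h1 : HasDerivAt (fun t => Real.sin (2 * Real.pi * t))
        (2 * Real.pi * Real.cos (2 * Real.pi * t)) t := by
      have := ((hasDerivAt_id t).const_mul (2 * Real.pi)).sin
      simpa [mul_comm] using this
    exact (hgd _).comp t h1
  set f : ℝ → ℝ := fun t => g (Real.cos (2 * Real.pi * t)) *
    (deriv g (Real.sin (2 * Real.pi * t)) * (2 * Real.pi * Real.cos (2 * Real.pi * t))) with hf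
  have hgc := hg.smooth.continuous
  have hgc' := hg.smooth.continuous_deriv (by simp)
  have hfc : Continuous f := by fun_prop
  have hSc : Continuous fun t =>
    deriv g (Real.sin (2 * Real.pi * t)) * (2 * Real.pi * Real.cos (2 * Real.pi * t)) := by fun_prop
  have hii : ∀ a b, IntervalIntegrable f MeasureTheory.volume a b := fun a b =>
    hfc.intervalIntegrable a b
  have hfneg : ∀ t, f (-t) = f t := fun t => by
    simp only [hf, mul_neg, Real.cos_neg, Real.sin_neg, hdeven]
  have hfhalf : ∀ t, f (t + 1 / 2) = f t := fun t => by
    have h1 : 2 * Real.pi * (t + 1 / 2) = 2 * Real.pi * t + Real.pi := by ring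
    simp only [hf, h1, Real.cos_add_pi, Real.sin_add_pi, hdeven, hgodd]
    ring
  have hquarter : ∫ t in (0 : ℝ)..1, f t = 4 * ∫ t in (0 : ℝ)..(1 / 4), f t := by
    have hp : Function.Periodic f (1 / 2) := hfhalf
    have h1 : ∫ t in (1 / 2 : ℝ)..1, f t = ∫ t in (0 : ℝ)..(1 / 2), f t := by
      have := hp.intervalIntegral_add_eq (1 / 2) 0
      norm_num at this ⊢
      exact this
    have h2 : ∫ t in (-(1 / 4) : ℝ)..(1 / 4), f t = ∫ t in (0 : ℝ)..(1 / 2), f t := by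
      have := hp.intervalIntegral_add_eq (-(1 / 4)) 0
      norm_num at this ⊢
      exact this
    have h3 : ∫ t in (-(1 / 4) : ℝ)..0, f t = ∫ t in (0 : ℝ)..(1 / 4), f t := by
      have := intervalIntegral.integral_comp_neg (a := 0) (b := 1 / 4) f
      simp only [hfneg, neg_zero] at this
      exact this.symm
    rw [← intervalIntegral.integral_add_adjacent_intervals (hii 0 (1 / 2)) (hii (1 / 2) 1), h1,
      ← h2, ← intervalIntegral.integral_add_adjacent_intervals (hii (-(1 / 4)) 0)
        (hii 0 (1 / 4)), h3]
    ring
  have hcos : ∀ t ∈ Icc (0 : ℝ) (1 / 4), 0 ≤ Real.cos (2 * Real.pi * t) := fun t ht =>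
    Real.cos_nonneg_of_neg_pi_div_two_le_of_le (by nlinarith [ht.1]) (by nlinarith [ht.2])
  have hint : ∀ b, ∫ t in (0 : ℝ)..b,
      deriv g (Real.sin (2 * Real.pi * t)) * (2 * Real.pi * Real.cos (2 * Real.pi * t)) =
        g (Real.sin (2 * Real.pi * b)) := fun b => by
    rw [intervalIntegral.integral_eq_sub_of_hasDerivAt (fun t _ => hS t)
      (hSc.intervalIntegrable _ _)]
    simp [hg0]
  have hnn : ∀ t ∈ Icc (0 : ℝ) (1 / 4), 0 ≤ deriv g (Real.sin (2 * Real.pi * t)) *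
      (2 * Real.pi * Real.cos (2 * Real.pi * t)) := fun t ht =>
    mul_nonneg (hg.deriv_pos _).le (mul_nonneg (by positivity) (hcos t ht))
  have hupper : ∫ t in (0 : ℝ)..(1 / 4), f t ≤ 1 := by
    have h1 : ∫ t in (0 : ℝ)..(1 / 4), f t ≤ ∫ t in (0 : ℝ)..(1 / 4),
        deriv g (Real.sin (2 * Real.pi * t)) * (2 * Real.pi * Real.cos (2 * Real.pi * t)) :=
      intervalIntegral.integral_mono_on (by norm_num) (hii _ _) (hSc.intervalIntegrable _ _)
        fun t ht => mul_le_of_le_one_left (hnn t ht) (hg.upper _).le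
    rw [hint] at h1
    exact h1.trans (hg.upper _).le
  have hlower : g (√2 / 2) ^ 2 ≤ ∫ t in (0 : ℝ)..(1 / 4), f t := by
    have h8 : ∀ t ∈ Icc (0 : ℝ) (1 / 8), t ∈ Icc (0 : ℝ) (1 / 4) := fun t ht =>
      ⟨ht.1, ht.2.trans (by norm_num)⟩
    have h1 : ∫ t in (0 : ℝ)..(1 / 8), g (√2 / 2) *
        (deriv g (Real.sin (2 * Real.pi * t)) * (2 * Real.pi * Real.cos (2 * Real.pi * t))) ≤
        ∫ t in (0 : ℝ)..(1 / 8), f t := by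
      refine intervalIntegral.integral_mono_on (by norm_num)
        ((continuous_const.mul hSc).intervalIntegrable _ _) (hii _ _) fun t ht => ?_
      refine mul_le_mul_of_nonneg_right (hg.strictMono.monotone ?_) (hnn t (h8 t ht))
      rw [← Real.cos_pi_div_four]
      exact Real.cos_le_cos_of_nonneg_of_le_pi (by nlinarith [ht.1]) (by linarith)
        (by nlinarith [ht.2])
    rw [intervalIntegral.integral_const_mul, hint,
      show 2 * Real.pi * (1 / 8) = Real.pi / 4 by ring, Real.sin_pi_div_four, ← sq] at h1
    have h2 : 0 ≤ ∫ t in (1 / 8 : ℝ)..(1 / 4), f t := by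
      refine intervalIntegral.integral_nonneg (by norm_num) fun t ht => ?_
      have ht' : t ∈ Icc (0 : ℝ) (1 / 4) := ⟨by linarith [ht.1], ht.2⟩
      refine mul_nonneg ?_ (hnn t ht')
      rw [← hg0]
      exact hg.strictMono.monotone (hcos t ht')
    rw [← intervalIntegral.integral_add_adjacent_intervals (hii 0 (1 / 8)) (hii (1 / 8) (1 / 4))]
    linarith
  set Q := ∫ t in (0 : ℝ)..(1 / 4), f t with hQ
  have hQ1 : 1 / (1 + ε) < Q := hK.trans_le hlower
  have hQ0 : 0 < Q := lt_trans (by positivity) hQ1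
  refine ⟨g, 1 / Q, fun t => 1 / Q / 4 * (g (Real.sin (2 * Real.pi * t)) + ∫ τ in (0 : ℝ)..t, f τ),
    hg, (one_le_div hQ0).2 hupper, ?_, fun t => ?_, ?_⟩
  · rw [div_lt_iff₀ hQ0]
    rw [div_lt_iff₀ (by linarith)] at hQ1
    linarith
  · have h1 := ((hS t).add (hfc.integral_hasStrictDerivAt 0 t).hasDerivAt).const_mul (1 / Q / 4)
    refine h1.congr_deriv ?_
    simp only [hf]
    ring
  · have h1 : Real.sin (2 * Real.pi * 1) = 0 := by rw [mul_one, Real.sin_two_pi]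
    have h0 : Real.sin (2 * Real.pi * 0) = 0 := by rw [mul_zero, Real.sin_zero]
    beta_reduce
    rw [h1, h0, hg0, hquarter, intervalIntegral.integral_same]
    field_simp
    ring

/-! ### The spiral -/

/-- Parameters of the spiralling motion: in the first factor the centre of the motion runs
through `M` turns around the origin and back, at actions that differ from `c` by at
most `9α`. The displacements of the disc take place in the last turn before each return, up to a
fraction `3δ` of that turn. -/
structure SpiralParams (h : ℝ) where
  M : ℝ
  δ : ℝ
  α : ℝ
  c : ℝ
  h_pos : 0 < h
  M_ge : 16 ≤ M
  δ_pos : 0 < δ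
  δ_le : δ ≤ 1 / 8
  α_pos : 0 < α
  c_gt : 9 * α + h / (1 - 3 * δ) < c

namespace SpiralParams

variable {h : ℝ} (P : SpiralParams h)

/-- The angle of the centre of the motion. -/
def θ (s : ℝ) : ℝ := -(P.M / 2 * Real.cos (2 * Real.pi * s))

/-- The outgoing and the returning branch of the spiral meet where `|cos (2πs)|` has this value,
slightly less than one turn away from the end points of the spiral. -/
def n : ℝ := 1 - 2 * (1 - P.δ) / P.M

/-- The action of the centre of the motion. -/
def r (s : ℝ) : ℝ :=
  P.c + 8 * P.α * Real.cos (2 * Real.pi * s) +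
    P.α * Real.sin (2 * Real.pi * s) * (P.n ^ 2 - Real.cos (2 * Real.pi * s) ^ 2)

/-- A smooth cut-off function of the last turn of the outgoing branch. -/
def cutoff (s : ℝ) : ℝ :=
  Real.smoothTransition ((-Real.cos (2 * Real.pi * s) - P.n) / (2 * P.δ / P.M)) *
    Real.smoothTransition ((Real.sin (2 * Real.pi * s) - P.δ / P.M) / (P.δ / P.M))

/-- The number of turns of the spiral in the support of the cut-off function, weighted by it. -/
def weight : ℝ := ∫ s in (0 : ℝ)..(1 / 2), P.cutoff s * (Real.pi * P.M * Real.sin (2 * Real.pi * s))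

/-- The strength of the displacement: the disc is pushed inwards in the last turn of the outgoing
branch and outwards in the last turn of the returning branch. -/
def l (s : ℝ) : ℝ := (P.cutoff s - P.cutoff (s + 1 / 2)) / (2 * P.weight)

/-- The rotation of the disc in the second factor. -/
def ρ (s : ℝ) : ℝ := -∫ τ in (0 : ℝ)..s, P.l τ * (Real.pi * P.M * Real.sin (2 * Real.pi * τ))

lemma M_pos : 0 < P.M := by linarith [P.M_ge]

lemma cos_add_half (s : ℝ) :
    Real.cos (2 * Real.pi * (s + 1 / 2)) = -Real.cos (2 * Real.pi * s) := by
  rw [show 2 * Real.pi * (s + 1 / 2) = 2 * Real.pi * s + Real.pi by ring, Real.cos_add_pi]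

lemma sin_add_half (s : ℝ) :
    Real.sin (2 * Real.pi * (s + 1 / 2)) = -Real.sin (2 * Real.pi * s) := by
  rw [show 2 * Real.pi * (s + 1 / 2) = 2 * Real.pi * s + Real.pi by ring, Real.sin_add_pi]

lemma cos_add_one (s : ℝ) : Real.cos (2 * Real.pi * (s + 1)) = Real.cos (2 * Real.pi * s) := by
  rw [mul_add, mul_one, Real.cos_add_two_pi]

lemma sin_add_one (s : ℝ) : Real.sin (2 * Real.pi * (s + 1)) = Real.sin (2 * Real.pi * s) := by
  rw [mul_add, mul_one, Real.sin_add_two_pi]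

lemma n_lt_one : P.n < 1 := by
  have : 0 < 2 * (1 - P.δ) / P.M := div_pos (by linarith [P.δ_le]) P.M_pos
  rw [n]
  linarith

/-- One turn of the spiral corresponds to a change of `cos (2πs)` by `2 / M`. -/
lemma one_sub_n : 1 - P.n = (1 - P.δ) * (2 / P.M) := by
  rw [n]
  ring

lemma two_div_M_le : 2 / P.M ≤ 1 / 8 := by
  rw [div_le_div_iff₀ P.M_pos (by norm_num)]
  linarith [P.M_ge]

lemma two_div_M_pos : 0 < 2 / P.M := div_pos two_pos P.M_pos

lemma n_ge : 7 / 8 ≤ P.n := by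
  have h1 := P.one_sub_n
  have h2 := P.two_div_M_le
  have h3 := P.two_div_M_pos
  nlinarith [P.δ_pos]

lemma one_sub_n_lt : 1 - P.n < 2 / P.M := by
  rw [one_sub_n]
  nlinarith [P.δ_pos, P.two_div_M_pos]

lemma hasDerivAt_cos (s : ℝ) : HasDerivAt (fun s => Real.cos (2 * Real.pi * s))
    (-(2 * Real.pi * Real.sin (2 * Real.pi * s))) s := by
  have := ((hasDerivAt_id s).const_mul (2 * Real.pi)).cos
  simp only [id, mul_one] at this
  exact this.congr_deriv (by ring)

lemma hasDerivAt_sin (s : ℝ) : HasDerivAt (fun s => Real.sin (2 * Real.pi * s))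
    (2 * Real.pi * Real.cos (2 * Real.pi * s)) s := by
  have := ((hasDerivAt_id s).const_mul (2 * Real.pi)).sin
  simp only [id, mul_one] at this
  exact this.congr_deriv (by ring)

lemma hasDerivAt_θ (s : ℝ) : HasDerivAt P.θ (Real.pi * P.M * Real.sin (2 * Real.pi * s)) s :=
  (((hasDerivAt_cos s).const_mul (P.M / 2)).neg).congr_deriv (by ring)

lemma deriv_θ (s : ℝ) : deriv P.θ s = Real.pi * P.M * Real.sin (2 * Real.pi * s) :=
  (P.hasDerivAt_θ s).deriv

lemma hasDerivAt_r (s : ℝ) : HasDerivAt P.r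
    (2 * Real.pi * P.α * (-(8 * Real.sin (2 * Real.pi * s)) +
      Real.cos (2 * Real.pi * s) * (P.n ^ 2 - Real.cos (2 * Real.pi * s) ^ 2) +
        2 * Real.sin (2 * Real.pi * s) ^ 2 * Real.cos (2 * Real.pi * s))) s := by
  have h1 := ((hasDerivAt_cos s).const_mul (8 * P.α)).const_add P.c
  have h2 := ((hasDerivAt_sin s).const_mul P.α).mul (((hasDerivAt_cos s).pow 2).const_sub (P.n ^ 2))
  refine (h1.add h2).congr_deriv ?_
  simp only [Pi.pow_apply]
  push_cast
  ring

lemma contDiff_cos : ContDiff ℝ ∞ fun s : ℝ => Real.cos (2 * Real.pi * s) :=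
  (contDiff_const.mul contDiff_id).cos

lemma contDiff_sin : ContDiff ℝ ∞ fun s : ℝ => Real.sin (2 * Real.pi * s) :=
  (contDiff_const.mul contDiff_id).sin

lemma contDiff_cutoff : ContDiff ℝ ∞ P.cutoff := by
  have h1 : ContDiff ℝ ∞ Real.smoothTransition := Real.smoothTransition.contDiff
  exact (h1.comp ((contDiff_cos.neg.sub contDiff_const).div_const _)).mul
    (h1.comp ((contDiff_sin.sub contDiff_const).div_const _))

lemma contDiff_l : ContDiff ℝ ∞ P.l :=
  (P.contDiff_cutoff.sub (P.contDiff_cutoff.comp (contDiff_id.add contDiff_const))).div_const _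

lemma hasDerivAt_ρ (s : ℝ) :
    HasDerivAt P.ρ (-(P.l s * (Real.pi * P.M * Real.sin (2 * Real.pi * s)))) s := by
  have hc : Continuous fun τ => P.l τ * (Real.pi * P.M * Real.sin (2 * Real.pi * τ)) := by
    have := P.contDiff_l.continuous
    fun_prop
  exact (hc.integral_hasStrictDerivAt 0 s).hasDerivAt.neg

lemma contDiff_ρ : ContDiff ℝ ∞ P.ρ := by
  rw [contDiff_infty_iff_deriv]
  refine ⟨fun s => (P.hasDerivAt_ρ s).differentiableAt, ?_⟩
  rw [show deriv P.ρ = _ from funext fun s => (P.hasDerivAt_ρ s).deriv]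
  exact (P.contDiff_l.mul (contDiff_const.mul contDiff_sin)).neg

/-! ### The displacements -/

lemma cutoff_nonneg (s : ℝ) : 0 ≤ P.cutoff s :=
  mul_nonneg (Real.smoothTransition.nonneg _) (Real.smoothTransition.nonneg _)

lemma cutoff_le_one (s : ℝ) : P.cutoff s ≤ 1 :=
  mul_le_one₀ (Real.smoothTransition.le_one _) (Real.smoothTransition.nonneg _)
    (Real.smoothTransition.le_one _)

lemma cutoff_add_one (s : ℝ) : P.cutoff (s + 1) = P.cutoff s := by
  rw [cutoff, cutoff, cos_add_one, sin_add_one]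

lemma cutoff_eq_zero_of_cos {s : ℝ} (hs : -Real.cos (2 * Real.pi * s) ≤ P.n) : P.cutoff s = 0 := by
  have h1 : 0 < 2 * P.δ / P.M := div_pos (by linarith [P.δ_pos]) P.M_pos
  rw [cutoff, Real.smoothTransition.zero_of_nonpos, zero_mul]
  exact div_nonpos_of_nonpos_of_nonneg (by linarith) h1.le

lemma cutoff_eq_zero_of_sin {s : ℝ} (hs : Real.sin (2 * Real.pi * s) ≤ P.δ / P.M) :
    P.cutoff s = 0 := by
  have h1 : 0 < P.δ / P.M := div_pos P.δ_pos P.M_pos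
  rw [cutoff, mul_comm, Real.smoothTransition.zero_of_nonpos, zero_mul]
  exact div_nonpos_of_nonpos_of_nonneg (by linarith) h1.le

lemma weight_ge : 1 - 3 * P.δ ≤ P.weight := by
  have hpi := Real.pi_pos
  have hM := P.M_pos
  have hδ := P.δ_pos
  have hδM : 0 < P.δ / P.M := div_pos hδ hM
  have hδM' : P.δ / P.M ≤ 1 / 128 := by
    rw [div_le_div_iff₀ hM (by norm_num)]
    linarith [P.M_ge, P.δ_le]
  have hn := P.n_ge
  have hc : Continuous fun s =>
      P.cutoff s * (Real.pi * P.M * Real.sin (2 * Real.pi * s)) := by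
    have := P.contDiff_cutoff.continuous
    fun_prop
  -- The cut-off function equals one on the interval `[a, b]`.
  set y₁ := P.n + 2 * P.δ / P.M with hy₁
  set y₂ := 1 - 2 * P.δ / P.M with hy₂
  have e1 : 2 * P.δ / P.M = 2 * (P.δ / P.M) := by ring
  have hy : y₁ ≤ y₂ := by
    have h1 := P.one_sub_n
    have h2 : P.δ * (2 / P.M) = 2 * P.δ / P.M := by ring
    have h3 : 0 < 2 / P.M := P.two_div_M_pos
    nlinarith [P.δ_le]
  set a := Real.arccos (-y₁) / (2 * Real.pi) with ha
  set b := Real.arccos (-y₂) / (2 * Real.pi) with hb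
  have ha' : 2 * Real.pi * a = Real.arccos (-y₁) := by rw [ha]; field_simp
  have hb' : 2 * Real.pi * b = Real.arccos (-y₂) := by rw [hb]; field_simp
  have ha0 : 0 ≤ a := div_nonneg (Real.arccos_nonneg _) (by positivity)
  have hb1 : b ≤ 1 / 2 := by
    rw [hb, div_le_iff₀ (by positivity)]
    linarith [Real.arccos_le_pi (-y₂)]
  have hab : a ≤ b := by
    rw [ha, hb]
    exact div_le_div_of_nonneg_right (Real.antitone_arccos (by linarith)) (by positivity)
  have hca : Real.cos (2 * Real.pi * a) = -y₁ := by
    rw [ha', Real.cos_arccos (by linarith) (by linarith)]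
  have hcb : Real.cos (2 * Real.pi * b) = -y₂ := by
    rw [hb', Real.cos_arccos (by linarith) (by linarith)]
  have hnn : ∀ s ∈ Icc (0 : ℝ) (1 / 2), 0 ≤ Real.sin (2 * Real.pi * s) := fun s hs =>
    Real.sin_nonneg_of_nonneg_of_le_pi (by nlinarith [hs.1]) (by nlinarith [hs.2])
  have hone : ∀ s ∈ Icc a b, P.cutoff s = 1 := by
    intro s hs
    have h1 : Real.cos (2 * Real.pi * s) ≤ -y₁ := by
      rw [← hca]
      exact Real.cos_le_cos_of_nonneg_of_le_pi (by nlinarith) (by nlinarith [hs.2])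
        (by nlinarith [hs.1])
    have h2 : -y₂ ≤ Real.cos (2 * Real.pi * s) := by
      rw [← hcb]
      exact Real.cos_le_cos_of_nonneg_of_le_pi (by nlinarith [hs.1]) (by nlinarith)
        (by nlinarith [hs.2])
    have h3 := hnn s ⟨ha0.trans hs.1, hs.2.trans hb1⟩
    have h4 := Real.sin_sq_add_cos_sq (2 * Real.pi * s)
    have h5 : 2 * (P.δ / P.M) ≤ Real.sin (2 * Real.pi * s) := by
      refine le_of_sq_le_sq ?_ h3
      have h6 : Real.cos (2 * Real.pi * s) ^ 2 ≤ y₂ ^ 2 := sq_le_sq.2 (by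
        rw [abs_of_nonneg (by linarith : 0 ≤ y₂), abs_le]
        exact ⟨h2, by linarith⟩)
      have h7 : y₂ = 1 - 2 * (P.δ / P.M) := by rw [hy₂, e1]
      rw [h7] at h6
      nlinarith
    rw [cutoff, Real.smoothTransition.one_of_one_le, Real.smoothTransition.one_of_one_le, one_mul]
    · rw [one_le_div hδM]
      linarith
    · rw [one_le_div (by linarith)]
      linarith
  have h1 : ∫ s in a..b, Real.pi * P.M * Real.sin (2 * Real.pi * s) ≤ P.weight := by
    have h2 : ∫ s in a..b, P.cutoff s * (Real.pi * P.M * Real.sin (2 * Real.pi * s)) ≤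
        P.weight := by
      refine intervalIntegral.integral_mono_interval ha0 hab hb1 ?_ (hc.intervalIntegrable _ _)
      refine (MeasureTheory.ae_restrict_iff' measurableSet_Ioc).2 (.of_forall fun s hs => ?_)
      exact mul_nonneg (P.cutoff_nonneg s) (mul_nonneg (by positivity) (hnn s ⟨hs.1.le, hs.2⟩))
    refine le_trans (le_of_eq ?_) h2
    refine intervalIntegral.integral_congr fun s hs => ?_
    rw [uIcc_of_le hab] at hs
    simp only [hone s hs, one_mul]
  rw [intervalIntegral.integral_eq_sub_of_hasDerivAt (fun s _ => P.hasDerivAt_θ s)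
    (by apply Continuous.intervalIntegrable; fun_prop), θ, θ, hca, hcb] at h1
  have h6 : -(P.M / 2 * -y₂) - -(P.M / 2 * -y₁) = 1 - 3 * P.δ := by
    rw [hy₁, hy₂, n]
    field_simp
    ring
  linarith

lemma weight_pos : 0 < P.weight := by
  linarith [P.weight_ge, P.δ_le]

lemma l_add_half (s : ℝ) : P.l (s + 1 / 2) = -P.l s := by
  rw [l, l, show s + 1 / 2 + 1 / 2 = s + 1 by ring, cutoff_add_one]
  ring

lemma l_eq_of_sin_nonneg {s : ℝ} (hs : 0 ≤ Real.sin (2 * Real.pi * s)) :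
    P.l s = P.cutoff s / (2 * P.weight) := by
  have h1 : 0 < P.δ / P.M := div_pos P.δ_pos P.M_pos
  rw [l, P.cutoff_eq_zero_of_sin (s := s + 1 / 2), sub_zero]
  rw [sin_add_half]
  linarith

lemma l_nonneg {s : ℝ} (hs : 0 ≤ Real.sin (2 * Real.pi * s)) : 0 ≤ P.l s := by
  rw [P.l_eq_of_sin_nonneg hs]
  exact div_nonneg (P.cutoff_nonneg _) (by linarith [P.weight_pos])

lemma l_nonpos {s : ℝ} (hs : Real.sin (2 * Real.pi * s) ≤ 0) : P.l s ≤ 0 := by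
  have h1 := P.l_nonneg (s := s + 1 / 2) (by rw [sin_add_half]; linarith)
  rw [l_add_half] at h1
  linarith

lemma l_eq_zero {s : ℝ} (hs : 0 ≤ Real.sin (2 * Real.pi * s))
    (hc : -Real.cos (2 * Real.pi * s) ≤ P.n) : P.l s = 0 := by
  rw [P.l_eq_of_sin_nonneg hs, P.cutoff_eq_zero_of_cos hc, zero_div]

lemma l_eq_zero' {s : ℝ} (hs : Real.sin (2 * Real.pi * s) ≤ 0)
    (hc : -P.n ≤ -Real.cos (2 * Real.pi * s)) : P.l s = 0 := by
  have h1 := P.l_eq_zero (s := s + 1 / 2) (by rw [sin_add_half]; linarith)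
    (by rw [cos_add_half]; linarith)
  rw [l_add_half] at h1
  linarith

lemma abs_l_le (s : ℝ) : |P.l s| ≤ 1 / (2 * (1 - 3 * P.δ)) := by
  have h0 : 0 < 1 - 3 * P.δ := by linarith [P.δ_le]
  rw [l, abs_div, abs_of_pos (by linarith [P.weight_pos] : 0 < 2 * P.weight)]
  refine div_le_div₀ zero_le_one ?_ (by linarith) (by linarith [P.weight_ge])
  rw [abs_le]
  constructor <;> linarith [P.cutoff_nonneg s, P.cutoff_le_one s, P.cutoff_nonneg (s + 1 / 2),
    P.cutoff_le_one (s + 1 / 2)]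

/-- Near the end points of the spiral there is no displacement. -/
lemma l_eventually_eq_zero {s : ℝ} (hs : Real.sin (2 * Real.pi * s) = 0) :
    P.l =ᶠ[𝓝 s] fun _ => 0 := by
  have h1 : 0 < P.δ / P.M := div_pos P.δ_pos P.M_pos
  have h2 : Filter.Tendsto (fun s => Real.sin (2 * Real.pi * s)) (𝓝 s) (𝓝 0) := by
    have := contDiff_sin.continuous.tendsto s
    rwa [hs] at this
  filter_upwards [h2.eventually_le_const h1, h2.eventually_const_le (neg_lt_zero.2 h1)]
    with τ h3 h4
  rw [l, P.cutoff_eq_zero_of_sin h3, P.cutoff_eq_zero_of_sin, sub_zero, zero_div]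
  rw [sin_add_half]
  linarith

/-- The displacement is strong enough to rotate the disc by half a turn. -/
lemma ρ_add_half (s : ℝ) : P.ρ (s + 1 / 2) = P.ρ s - 1 / 2 := by
  have hpi := Real.pi_pos
  have hW := P.weight_pos
  set f : ℝ → ℝ := fun τ => P.l τ * (Real.pi * P.M * Real.sin (2 * Real.pi * τ)) with hf
  have hfc : Continuous f := by
    have := P.contDiff_l.continuous
    fun_prop
  have hper : Function.Periodic f (1 / 2) := fun τ => by
    simp only [hf, l_add_half, sin_add_half]
    ring
  have h1 : ∫ τ in (0 : ℝ)..(1 / 2), f τ = 1 / 2 := by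
    have h2 : ∫ τ in (0 : ℝ)..(1 / 2), f τ = ∫ τ in (0 : ℝ)..(1 / 2), 1 / (2 * P.weight) *
        (P.cutoff τ * (Real.pi * P.M * Real.sin (2 * Real.pi * τ))) := by
      refine intervalIntegral.integral_congr fun τ hτ => ?_
      rw [uIcc_of_le (by norm_num)] at hτ
      have h3 : 0 ≤ Real.sin (2 * Real.pi * τ) :=
        Real.sin_nonneg_of_nonneg_of_le_pi (by nlinarith [hτ.1]) (by nlinarith [hτ.2])
      simp only [hf, P.l_eq_of_sin_nonneg h3]
      ring
    rw [h2, intervalIntegral.integral_const_mul, ← weight]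
    field_simp
  have h2 := hper.intervalIntegral_add_eq s 0
  rw [zero_add, h1] at h2
  rw [ρ, ρ, ← intervalIntegral.integral_add_adjacent_intervals (hfc.intervalIntegrable 0 s)
    (hfc.intervalIntegrable s (s + 1 / 2)), h2]
  ring

lemma ρ_eq_zero {s : ℝ} (h0 : 0 ≤ s) (h1 : s ≤ 1 / 2)
    (hc : -Real.cos (2 * Real.pi * s) ≤ P.n) : P.ρ s = 0 := by
  have hpi := Real.pi_pos
  rw [ρ, neg_eq_zero]
  refine (intervalIntegral.integral_congr (g := fun _ => (0 : ℝ)) fun τ hτ => ?_).trans (by simp)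
  rw [uIcc_of_le h0] at hτ
  have h2 : 0 ≤ Real.sin (2 * Real.pi * τ) :=
    Real.sin_nonneg_of_nonneg_of_le_pi (by nlinarith [hτ.1]) (by nlinarith [hτ.2])
  have h3 : Real.cos (2 * Real.pi * s) ≤ Real.cos (2 * Real.pi * τ) :=
    Real.cos_le_cos_of_nonneg_of_le_pi (by nlinarith [hτ.1]) (by nlinarith) (by nlinarith [hτ.2])
  simp only [P.l_eq_zero h2 (by linarith), zero_mul]

lemma exists_ρ_eq_int {s : ℝ} (hs : 0 ≤ Real.sin (2 * Real.pi * s))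
    (hc : -Real.cos (2 * Real.pi * s) ≤ P.n) : ∃ k : ℤ, P.ρ s = k := by
  have hpi := Real.pi_pos
  have hρ : Function.Periodic (fun s => P.ρ s + s) 1 := fun s => by
    simp only [show s + 1 = s + 1 / 2 + 1 / 2 by ring, ρ_add_half]
    ring
  have h1 := hρ.sub_int_mul_eq (x := s) ⌊s⌋
  simp only [mul_one, Int.self_sub_floor] at h1
  have h2 : 2 * Real.pi * s = 2 * Real.pi * Int.fract s + ⌊s⌋ * (2 * Real.pi) := by
    linear_combination (-2 * Real.pi) * Int.floor_add_fract s
  rw [h2, Real.sin_add_int_mul_two_pi] at hs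
  rw [h2, Real.cos_add_int_mul_two_pi] at hc
  have h3 := Int.fract_nonneg s
  have h4 := Int.fract_lt_one s
  have h5 : Int.fract s ≤ 1 / 2 := by
    by_contra! h6
    have h7 : Real.sin (2 * Real.pi * Int.fract s - 2 * Real.pi) < 0 :=
      Real.sin_neg_of_neg_of_neg_pi_lt (by nlinarith) (by nlinarith)
    rw [Real.sin_sub_two_pi] at h7
    linarith
  refine ⟨-⌊s⌋, ?_⟩
  rw [P.ρ_eq_zero h3 h5 hc] at h1
  push_cast
  linarith [Int.floor_add_fract s]

lemma exists_ρ_eq_int_add_half {s : ℝ} (hs : Real.sin (2 * Real.pi * s) ≤ 0)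
    (hc : -P.n ≤ -Real.cos (2 * Real.pi * s)) : ∃ k : ℤ, P.ρ s = k + 1 / 2 := by
  obtain ⟨k, hk⟩ := P.exists_ρ_eq_int (s := s + 1 / 2) (by rw [sin_add_half]; linarith)
    (by rw [cos_add_half]; linarith)
  rw [ρ_add_half] at hk
  exact ⟨k, by linarith⟩

/-! ### Comparison of the branches of the spiral -/

lemma abs_r_sub_le (s : ℝ) : |P.r s - P.c| ≤ 9 * P.α := by
  have hα := P.α_pos
  have h1 : |P.n ^ 2 - Real.cos (2 * Real.pi * s) ^ 2| ≤ 1 := by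
    have h2 := Real.cos_sq_le_one (2 * Real.pi * s)
    have h3 := sq_nonneg (Real.cos (2 * Real.pi * s))
    have h4 : P.n ^ 2 ≤ 1 := by nlinarith [P.n_lt_one, P.n_ge]
    rw [abs_le]
    constructor <;> nlinarith [sq_nonneg P.n]
  have h2 : |Real.sin (2 * Real.pi * s) * (P.n ^ 2 - Real.cos (2 * Real.pi * s) ^ 2)| ≤ 1 := by
    rw [abs_mul]
    exact mul_le_one₀ (Real.abs_sin_le_one _) (abs_nonneg _) h1
  have h3 : P.r s - P.c = P.α * (8 * Real.cos (2 * Real.pi * s) +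
      Real.sin (2 * Real.pi * s) * (P.n ^ 2 - Real.cos (2 * Real.pi * s) ^ 2)) := by
    rw [r]
    ring
  rw [h3, abs_mul, abs_of_pos hα, mul_comm 9]
  refine mul_le_mul_of_nonneg_left ?_ hα.le
  have h4 := abs_le.1 h2
  rw [abs_le]
  constructor <;> linarith [Real.neg_one_le_cos (2 * Real.pi * s),
    Real.cos_le_one (2 * Real.pi * s)]

/-- On either half of the circle, the function `8 cos + sin (n² - cos²)` increases whenever `cos`
increases by more than `1 - n`: its second term equals `sin³ - (1 - n²) sin`, where the cube varies
by at most four times the change of `cos` and the linear term is small. -/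
lemma gap_pos_of_turn {n τ S S' C C' : ℝ} (h1 : S ^ 2 + C ^ 2 = 1) (h2 : S' ^ 2 + C' ^ 2 = 1)
    (hS : |S| ≤ 1) (hS' : |S'| ≤ 1) (hC : |C| ≤ 1) (hC' : |C'| ≤ 1) (hn0 : 0 ≤ n) (hn1 : n < 1)
    (hτ : 1 - n < τ) (hss : 0 ≤ S * S') (ht : τ ≤ C - C') :
    0 < 8 * (C - C') + S * (n ^ 2 - C ^ 2) - S' * (n ^ 2 - C' ^ 2) := by
  obtain ⟨t, ht'⟩ : ∃ t, t = C - C' := ⟨_, rfl⟩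
  obtain ⟨m, hm⟩ : ∃ m, m = 1 - n ^ 2 := ⟨_, rfl⟩
  have ht0 : 0 < t := by linarith
  have hm0 : 0 ≤ m := by rw [hm]; nlinarith only [hn0, hn1]
  have hmt : m < 2 * t := by
    have : m = (1 - n) * (1 + n) := by rw [hm]; ring
    rw [this]
    have h3 : 1 - n < t := by linarith
    nlinarith only [h3, hn0, hn1]
  have hsum : |S + S'| ≤ 2 := (abs_add_le _ _).trans (by linarith)
  have hdiff : |S - S'| ≤ 2 := (abs_sub _ _).trans (by linarith)
  have hsumC : |C + C'| ≤ 2 := (abs_add_le _ _).trans (by linarith)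
  -- The differences of the cubes and of the values of the sine are estimated separately.
  have hsq : |S - S'| * |S + S'| ≤ 2 * t := by
    rw [← abs_mul, show (S - S') * (S + S') = -(t * (C + C')) by rw [ht']; linarith, abs_neg,
      abs_mul, abs_of_pos ht0, mul_comm]
    exact mul_le_mul_of_nonneg_right hsumC ht0.le
  have hcube : |S ^ 3 - S' ^ 3| ≤ 4 * t := by
    have h3 : |S ^ 2 + S * S' + S' ^ 2| ≤ |S + S'| * |S + S'| := by
      rw [abs_mul_abs_self, abs_of_nonneg (by positivity)]
      linarith only [hss]
    calc |S ^ 3 - S' ^ 3| = |S - S'| * |S ^ 2 + S * S' + S' ^ 2| := by rw [← abs_mul]; ring_nf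
      _ ≤ |S - S'| * (|S + S'| * |S + S'|) := mul_le_mul_of_nonneg_left h3 (abs_nonneg _)
      _ = |S - S'| * |S + S'| * |S + S'| := by ring
      _ ≤ 2 * t * 2 := mul_le_mul hsq hsum (abs_nonneg _) (by linarith)
      _ = 4 * t := by ring
  have hlin : |m * (S - S')| ≤ m * 2 := by
    rw [abs_mul, abs_of_nonneg hm0]
    exact mul_le_mul_of_nonneg_left hdiff hm0
  have e1 := abs_le.1 hcube
  have e2 := abs_le.1 hlin
  have e3 : 8 * (C - C') + S * (n ^ 2 - C ^ 2) - S' * (n ^ 2 - C' ^ 2) =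
      8 * t + (S ^ 3 - S' ^ 3) - m * (S - S') := by
    rw [hm, ht']
    linear_combination (-S) * h1 + S' * h2
  rw [e3]
  linarith only [e1.1, e2.2, hmt]

/-- The function `8 cos + sin (n² - cos²)` is smaller where `sin ≥ 0` than where `sin ≤ 0`, at the
same or a larger value of `cos`, provided that `cos < -n` at the former point or `n < cos` at the
latter. -/
lemma gap_pos_of_last_turn {n S S' C C' : ℝ} (h1 : S ^ 2 + C ^ 2 = 1) (h2 : S' ^ 2 + C' ^ 2 = 1)
    (hS : |S| ≤ 1) (hS' : |S'| ≤ 1) (hn0 : 0 ≤ n) (hn1 : n < 1)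
    (hs : S ≤ 0) (hs' : 0 ≤ S') (hne : S ≠ 0 ∨ S' ≠ 0) (hle : C' ≤ C)
    (hlast : n < -C' ∨ -C < -n) :
    0 < 8 * (C - C') + S * (n ^ 2 - C ^ 2) - S' * (n ^ 2 - C' ^ 2) := by
  have hS1 := (abs_le.1 hS).1
  have hS1' := (abs_le.1 hS').2
  rcases eq_or_lt_of_le hle with heq | hlt
  · have h3 : S' = -S := by
      have h4 : (S' - S) * (S' + S) = 0 := by rw [heq] at h2; linear_combination h2 - h1
      rcases mul_eq_zero.1 h4 with h5 | h5
      · have h6 : S = 0 := by linarith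
        have h7 : S' = 0 := by linarith
        simp [h6, h7] at hne
      · linarith
    have h4 : S < 0 := by
      refine lt_of_le_of_ne hs fun h5 => ?_
      rw [h3, h5] at hne
      simp at hne
    have h5 : n ^ 2 < C ^ 2 := by
      rw [heq] at hlast
      rcases hlast with h6 | h6 <;> nlinarith only [h6, hn0]
    rw [heq, h3]
    nlinarith only [h4, h5]
  · rcases hlast with h3 | h3
    · have h4 : 0 ≤ S' * (C' ^ 2 - n ^ 2) := mul_nonneg hs' (by nlinarith only [h3, hn0])
      have h5 : -(2 * (C - C')) ≤ S * (n ^ 2 - C ^ 2) := by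
        rcases le_total (n ^ 2) (C ^ 2) with h6 | h6
        · nlinarith only [h6, hs, hlt]
        · have h7 := abs_le_of_sq_le_sq' h6 hn0
          have h8 : n ^ 2 - C ^ 2 ≤ 2 * (n + C) := by nlinarith only [h7.1, h7.2, hn1]
          nlinarith only [h8, hS1, h6, h3]
      linarith
    · have h4 : 0 ≤ S * (n ^ 2 - C ^ 2) :=
        mul_nonneg_of_nonpos_of_nonpos hs (by nlinarith only [h3, hn0])
      have h5 : S' * (n ^ 2 - C' ^ 2) ≤ 2 * (C - C') := by
        rcases le_total (n ^ 2) (C' ^ 2) with h6 | h6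
        · nlinarith only [h6, hs', hlt]
        · have h7 := abs_le_of_sq_le_sq' h6 hn0
          have h8 : n ^ 2 - C' ^ 2 ≤ 2 * (n - C') := by nlinarith only [h7.1, h7.2, hn1]
          nlinarith only [h8, hS1', h6, h3]
      linarith

/-- On each branch, the action decreases when the angle increases by one turn or more. -/
lemma r_lt_of_turn {s s' : ℝ} (hss : 0 ≤ Real.sin (2 * Real.pi * s) * Real.sin (2 * Real.pi * s'))
    (ht : 2 / P.M ≤ Real.cos (2 * Real.pi * s) - Real.cos (2 * Real.pi * s')) : P.r s' < P.r s := by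
  have := mul_pos P.α_pos (gap_pos_of_turn (Real.sin_sq_add_cos_sq _) (Real.sin_sq_add_cos_sq _)
    (Real.abs_sin_le_one _) (Real.abs_sin_le_one _) (Real.abs_cos_le_one _) (Real.abs_cos_le_one _)
    (by linarith [P.n_ge]) P.n_lt_one P.one_sub_n_lt hss ht)
  rw [r, r]
  linarith

/-- Where one of the branches is in its last turn, the outgoing branch has smaller action than
the returning branch at the same or at a smaller angle. -/
lemma r_lt_of_last_turn {s s' : ℝ} (hs : Real.sin (2 * Real.pi * s) ≤ 0)
    (hs' : 0 ≤ Real.sin (2 * Real.pi * s'))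
    (hne : Real.sin (2 * Real.pi * s) ≠ 0 ∨ Real.sin (2 * Real.pi * s') ≠ 0)
    (hle : Real.cos (2 * Real.pi * s') ≤ Real.cos (2 * Real.pi * s))
    (hlast : P.n < -Real.cos (2 * Real.pi * s') ∨ -Real.cos (2 * Real.pi * s) < -P.n) :
    P.r s' < P.r s := by
  have := mul_pos P.α_pos (gap_pos_of_last_turn (Real.sin_sq_add_cos_sq _)
    (Real.sin_sq_add_cos_sq _) (Real.abs_sin_le_one _) (Real.abs_sin_le_one _)
    (by linarith [P.n_ge]) P.n_lt_one hs hs' hne hle hlast)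
  rw [r, r]
  linarith

lemma exists_eq_add_int {s s' : ℝ} (hcos : Real.cos (2 * Real.pi * s') = Real.cos (2 * Real.pi * s))
    (hsin : Real.sin (2 * Real.pi * s') = Real.sin (2 * Real.pi * s)) : ∃ n : ℤ, s' = s + n := by
  have h1 : Real.cos (2 * Real.pi * s' - 2 * Real.pi * s) = 1 := by
    rw [Real.cos_sub, hcos, hsin]
    linarith [Real.sin_sq_add_cos_sq (2 * Real.pi * s)]
  obtain ⟨n, hn⟩ := (Real.cos_eq_one_iff _).1 h1
  refine ⟨n, ?_⟩
  have hpi := Real.pi_pos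
  have h2 : 2 * Real.pi * (s' - s - n) = 0 := by linarith
  have := (mul_eq_zero.1 h2).resolve_left (by positivity)
  linarith

lemma cos_sub_cos_of_θ {s s' : ℝ} {k : ℤ} (hθ : P.θ s' = P.θ s + k) :
    Real.cos (2 * Real.pi * s) - Real.cos (2 * Real.pi * s') = k * (2 / P.M) := by
  have hM := P.M_pos
  rw [θ, θ] at hθ
  field_simp
  linarith

/-- Two positions whose first factors meet are equal or differ by half a turn in the second
factor. -/
lemma inj_of_nonneg {s s' v : ℝ} {k : ℤ} (hk : 0 ≤ k) (hv : 0 < v) (hθ : P.θ s' = P.θ s + k)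
    (hr : P.r s - P.l s * v = P.r s' - P.l s' * v) :
    (∃ n : ℤ, s' = s + n) ∨ ∃ n : ℤ, P.ρ s' = P.ρ s + n + 1 / 2 := by
  have hcc := P.cos_sub_cos_of_θ hθ
  have hM := P.two_div_M_pos
  have hn := P.one_sub_n_lt
  have h1 := Real.sin_sq_add_cos_sq (2 * Real.pi * s)
  have h2 := Real.sin_sq_add_cos_sq (2 * Real.pi * s')
  have b1 := Real.cos_le_one (2 * Real.pi * s)
  have b2 := Real.neg_one_le_cos (2 * Real.pi * s')
  have hle : Real.cos (2 * Real.pi * s') ≤ Real.cos (2 * Real.pi * s) := by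
    have : (0 : ℝ) ≤ k * (2 / P.M) := mul_nonneg (by exact_mod_cast hk) hM.le
    linarith
  have hturn : k ≠ 0 → 2 / P.M ≤ Real.cos (2 * Real.pi * s) - Real.cos (2 * Real.pi * s') := by
    intro hk0
    have : (1 : ℝ) ≤ k := by exact_mod_cast (by omega : 1 ≤ k)
    rw [hcc]
    nlinarith only [this, hM]
  -- The equality of the first factors, in the form in which the signs of `l` contradict it.
  have hmono : P.l s ≤ P.l s' → P.r s ≤ P.r s' := fun h => by nlinarith only [h, hv, hr]
  by_cases hss : 0 ≤ Real.sin (2 * Real.pi * s) * Real.sin (2 * Real.pi * s')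
  · left
    by_cases hk0 : k = 0
    · rw [hk0, Int.cast_zero, zero_mul] at hcc
      refine exists_eq_add_int (by linarith) ?_
      have h3 : Real.sin (2 * Real.pi * s') ^ 2 = Real.sin (2 * Real.pi * s) ^ 2 := by
        have : Real.cos (2 * Real.pi * s') = Real.cos (2 * Real.pi * s) := by linarith
        rw [this] at h2
        linarith
      rcases sq_eq_sq_iff_eq_or_eq_neg.1 h3 with h4 | h4
      · exact h4
      · rw [h4] at hss
        have : Real.sin (2 * Real.pi * s) = 0 := by nlinarith only [hss]
        rw [h4, this, neg_zero]
    · have ht := hturn hk0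
      refine absurd (hmono ?_) (not_le.2 (P.r_lt_of_turn hss ht))
      rcases mul_nonneg_iff.1 hss with ⟨h3, h4⟩ | ⟨h3, h4⟩
      · rw [P.l_eq_zero h3 (by linarith)]
        exact P.l_nonneg h4
      · rw [P.l_eq_zero' h4 (by linarith)]
        exact P.l_nonpos h3
  · rcases mul_neg_iff.1 (not_le.1 hss) with ⟨h3, h4⟩ | ⟨h3, h4⟩
    · by_cases hY : -Real.cos (2 * Real.pi * s) ≤ P.n ∧ -P.n ≤ -Real.cos (2 * Real.pi * s')
      · right
        obtain ⟨i, hi⟩ := P.exists_ρ_eq_int h3.le hY.1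
        obtain ⟨j, hj⟩ := P.exists_ρ_eq_int_add_half h4.le hY.2
        exact ⟨j - i, by push_cast; linarith⟩
      · -- One of the positions is in a last turn of the spiral, so the angles are equal.
        have hlast : P.n < -Real.cos (2 * Real.pi * s) ∨ -Real.cos (2 * Real.pi * s') < -P.n := by
          by_contra! h5
          exact hY h5
        have hk0 : k = 0 := by
          by_contra hk0
          have := hturn hk0
          rcases hlast with h5 | h5 <;> linarith
        rw [hk0, Int.cast_zero, zero_mul] at hcc
        have h5 := P.r_lt_of_last_turn h4.le h3.le (Or.inl h4.ne) (by linarith) hlast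
        have h6 := P.l_nonneg h3.le
        have h7 := P.l_nonpos h4.le
        nlinarith only [h5, h6, h7, hv, hr]
    · by_cases hY : -P.n ≤ -Real.cos (2 * Real.pi * s) ∧ -Real.cos (2 * Real.pi * s') ≤ P.n
      · right
        obtain ⟨i, hi⟩ := P.exists_ρ_eq_int_add_half h3.le hY.1
        obtain ⟨j, hj⟩ := P.exists_ρ_eq_int h4.le hY.2
        exact ⟨j - i - 1, by push_cast; linarith⟩
      · have hlast : P.n < -Real.cos (2 * Real.pi * s') ∨ -Real.cos (2 * Real.pi * s) < -P.n := by
          by_contra! h5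
          exact hY ⟨h5.2, h5.1⟩
        refine absurd (hmono ?_) (not_le.2
          (P.r_lt_of_last_turn h3.le h4.le (Or.inl h3.ne) hle hlast))
        exact (P.l_nonpos h3.le).trans (P.l_nonneg h4.le)

/-- The steering given by the spiral. -/
def steering : Steering h where
  θ := P.θ
  r := P.r
  l := P.l
  ρ := P.ρ
  speed := Real.pi * P.M
  h_pos := P.h_pos
  θ_smooth := (contDiff_const.mul contDiff_cos).neg
  r_smooth := (contDiff_const.add (contDiff_const.mul contDiff_cos)).add
    ((contDiff_const.mul contDiff_sin).mul (contDiff_const.sub (contDiff_cos.pow 2)))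
  l_smooth := P.contDiff_l
  ρ_smooth := P.contDiff_ρ
  θ_add_one s := by rw [θ, θ, cos_add_one]
  r_add_one s := by rw [r, r, cos_add_one, sin_add_one]
  l_add_one s := by
    rw [show s + 1 = s + 1 / 2 + 1 / 2 by ring, l_add_half, l_add_half, neg_neg]
  ρ_add_one s := by
    rw [show s + 1 = s + 1 / 2 + 1 / 2 by ring, ρ_add_half, ρ_add_half]
    ring
  speed_pos := mul_pos Real.pi_pos P.M_pos
  deriv_θ := P.deriv_θ
  deriv_ρ s := by rw [(P.hasDerivAt_ρ s).deriv, deriv_θ]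
  pos s v h0 h1 := by
    have h2 := abs_le.1 (P.abs_l_le s)
    have h3 := abs_le.1 (P.abs_r_sub_le s)
    have h4 := P.c_gt
    have h5 : 0 < 1 - 3 * P.δ := by linarith [P.δ_le]
    have h6 : P.l s * v ≤ 1 / (2 * (1 - 3 * P.δ)) * (2 * h) :=
      mul_le_mul h2.2 h1.le h0.le (by positivity)
    have h7 : 1 / (2 * (1 - 3 * P.δ)) * (2 * h) = h / (1 - 3 * P.δ) := by field_simp
    linarith
  inj s s' v k h0 _ hθ hr := by
    rcases le_total 0 k with hk | hk
    · exact P.inj_of_nonneg hk h0 hθ hr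
    · rcases P.inj_of_nonneg (k := -k) (by omega) h0 (by push_cast; linarith) hr.symm with
        ⟨n, hn⟩ | ⟨n, hn⟩
      · exact Or.inl ⟨-n, by push_cast; linarith⟩
      · exact Or.inr ⟨-n - 1, by push_cast; linarith⟩
  turn s hs := by
    have h1 := P.l_eventually_eq_zero hs
    refine ⟨h1.eq_of_nhds, by rw [h1.deriv_eq, deriv_const], ?_⟩
    have h2 := Real.sin_sq_add_cos_sq (2 * Real.pi * s)
    rw [hs] at h2
    have h3 : Real.cos (2 * Real.pi * s) ^ 2 = 1 := by linarith
    rw [(P.hasDerivAt_r s).deriv, hs, h3]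
    have h4 : P.n ^ 2 < 1 := by nlinarith [P.n_lt_one, P.n_ge]
    have h5 : 2 * Real.pi * P.α * (-(8 * 0) + Real.cos (2 * Real.pi * s) * (P.n ^ 2 - 1) +
        2 * 0 ^ 2 * Real.cos (2 * Real.pi * s)) * Real.cos (2 * Real.pi * s) =
        2 * Real.pi * P.α * (P.n ^ 2 - 1) := by
      linear_combination (2 * Real.pi * P.α * (P.n ^ 2 - 1)) * h3
    rw [h5]
    have := Real.pi_pos
    have := P.α_pos
    exact mul_neg_of_pos_of_neg (by positivity) (by linarith)

end SpiralParams

namespace SpiralParams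

variable {h : ℝ} (P : SpiralParams h) {g : ℝ → ℝ}

/-! ### The area and the position of the spiralling torus -/

/-- A primitive of `r θ' + 2h ρ'`; its increase over a period is the area of the class of the
motion. -/
def areaPrimitive (s : ℝ) : ℝ :=
  -(P.c * P.M / 2 * Real.cos (2 * Real.pi * s)) +
    2 * P.α * P.M * Real.sin (2 * Real.pi * s) ^ 2 +
    Real.pi * P.M * P.α * (P.n ^ 2 *
      (s / 2 - Real.sin (2 * Real.pi * s) * Real.cos (2 * Real.pi * s) / (4 * Real.pi)) -
      (s / 8 - Real.sin (2 * Real.pi * s) * Real.cos (2 * Real.pi * s) *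
        (1 - 2 * Real.sin (2 * Real.pi * s) ^ 2) / (16 * Real.pi))) +
    2 * h * P.ρ s

lemma hasDerivAt_areaPrimitive (s : ℝ) : HasDerivAt P.areaPrimitive
    (P.steering.r s * deriv P.steering.θ s + 2 * h * deriv P.steering.ρ s) s := by
  have hpi := Real.pi_pos
  have hC := hasDerivAt_cos s
  have hS := hasDerivAt_sin s
  have hid := hasDerivAt_id s
  have h1 := (hC.const_mul (P.c * P.M / 2)).neg
  have h2 := (hS.pow 2).const_mul (2 * P.α * P.M)
  have h3 := ((hid.div_const 2).sub ((hS.mul hC).div_const (4 * Real.pi))).const_mul (P.n ^ 2)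
  have h4 := (hid.div_const 8).sub
    (((hS.mul hC).mul (((hS.pow 2).const_mul 2).const_sub 1)).div_const (16 * Real.pi))
  have h5 := ((h1.add h2).add ((h3.sub h4).const_mul (Real.pi * P.M * P.α))).add
    ((P.hasDerivAt_ρ s).const_mul (2 * h))
  refine HasDerivAt.congr_deriv (h5.congr_of_eventuallyEq (.of_forall fun τ => ?_)) ?_
  · simp only [areaPrimitive, Pi.add_apply, Pi.sub_apply, Pi.mul_apply, Pi.neg_apply,
      Pi.pow_apply, id]
  · change _ = P.r s * deriv P.θ s + 2 * h * deriv P.ρ s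
    rw [P.deriv_θ, (P.hasDerivAt_ρ s).deriv, r]
    have h6 : Real.cos (2 * Real.pi * s) ^ 2 = 1 - Real.sin (2 * Real.pi * s) ^ 2 := by
      linarith [Real.sin_sq_add_cos_sq (2 * Real.pi * s)]
    simp only [Pi.mul_apply, Pi.pow_apply]
    generalize Real.cos (2 * Real.pi * s) = C at *
    generalize Real.sin (2 * Real.pi * s) = S at *
    push_cast
    field_simp
    simp only [h6]
    ring_nf

lemma areaPrimitive_one_sub_zero : P.areaPrimitive 1 - P.areaPrimitive 0 =
    Real.pi * P.M * P.α * (P.n ^ 2 / 2 - 1 / 8) - 2 * h := by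
  have h1 := P.steering.ρ_add_one 0
  change P.ρ (0 + 1) = P.ρ 0 - 1 at h1
  rw [zero_add] at h1
  rw [areaPrimitive, areaPrimitive, h1]
  simp
  ring

/-- There is a line `{z = a}` disjoint from the solid torus around which the motion turns once. -/
lemma exists_line (hg : IsProfile g) : ∃ a : ℂ, (∀ q, (P.steering.solid g q).1 ≠ a) ∧
    HasArgument (fun p => (P.steering.torus g p).1 - a) 1 0 := by
  have hpi := Real.pi_pos
  have hα := P.α_pos
  have hM := P.two_div_M_pos
  have hn := P.n_lt_one
  have hn0 := P.n_ge
  have hn1 := P.one_sub_n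
  have hδ := P.δ_pos
  have hδ1 := P.δ_le
  have hM1 := P.two_div_M_le
  -- On the returning branch, `s₀` comes slightly after the crossing of the branches at `cos = -n`.
  obtain ⟨Y, hY⟩ : ∃ Y, Y = P.n - P.δ / 2 * (2 / P.M) := ⟨_, rfl⟩
  have hYn : Y < P.n := by nlinarith only [hY, hδ, hM]
  have hY0 : 1 / 2 < Y := by nlinarith only [hY, hδ1, hM, hM1, hn0]
  obtain ⟨s₀, hc, hs⟩ : ∃ s₀, Real.cos (2 * Real.pi * s₀) = -Y ∧
      Real.sin (2 * Real.pi * s₀) < 0 := by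
    refine ⟨-(Real.arccos (-Y) / (2 * Real.pi)), ?_, ?_⟩
    · rw [mul_neg, Real.cos_neg, mul_div_cancel₀ _ (by positivity),
        Real.cos_arccos (by linarith) (by linarith)]
    · rw [mul_neg, Real.sin_neg, mul_div_cancel₀ _ (by positivity), Real.sin_arccos, neg_lt_zero,
        Real.sqrt_pos]
      nlinarith only [hY0, hYn, hn]
  have hgap : 0 < P.n ^ 2 - Real.cos (2 * Real.pi * s₀) ^ 2 := by
    rw [hc]
    nlinarith only [hY0, hYn]
  have hl₀ : P.l s₀ = 0 := P.l_eq_zero' hs.le (by linarith)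
  obtain ⟨r₀, hr₀⟩ : ∃ r₀, r₀ = P.c + 8 * P.α * Real.cos (2 * Real.pi * s₀) := ⟨_, rfl⟩
  have hc_pos : 9 * P.α < P.c := by
    have : 0 < h / (1 - 3 * P.δ) := div_pos P.h_pos (by linarith)
    linarith [P.c_gt]
  refine ⟨_, P.steering.hasArgument_torus_fst_sub hg (r₀ := r₀) (s₀ := s₀) ?_ ?_ ?_ hl₀ ?_⟩
  · rw [hr₀, hc]
    nlinarith only [hc_pos, hα, hYn, hn]
  · intro s v k hs1 hs2 hv _ hθ
    change r₀ < P.r s - P.l s * v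
    have hcc := P.cos_sub_cos_of_θ hθ
    have h1 := Real.sin_sq_add_cos_sq (2 * Real.pi * s)
    have h2 := Real.sin_sq_add_cos_sq (2 * Real.pi * s₀)
    have b := Real.neg_one_le_cos (2 * Real.pi * s)
    have hk : k < 1 := by
      by_contra! hk
      have : (1 : ℝ) ≤ k := by exact_mod_cast hk
      nlinarith only [this, hcc, hc, b, hY, hn1, hM, hδ]
    rcases eq_or_lt_of_le (Int.lt_add_one_iff.1 hk : k ≤ 0) with hk0 | hk0
    · rw [hk0, Int.cast_zero, zero_mul] at hcc
      have hce : Real.cos (2 * Real.pi * s) = Real.cos (2 * Real.pi * s₀) := by linarith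
      have hse : Real.sin (2 * Real.pi * s) = -Real.sin (2 * Real.pi * s₀) := by
        have h3 : Real.sin (2 * Real.pi * s) ^ 2 = Real.sin (2 * Real.pi * s₀) ^ 2 := by
          rw [hce] at h1
          linarith
        refine (sq_eq_sq_iff_eq_or_eq_neg.1 h3).resolve_left fun h4 => ?_
        obtain ⟨i, hi⟩ := exists_eq_add_int hce h4
        have h5 : (0 : ℝ) < i := by linarith
        have h6 : (i : ℝ) < 1 := by linarith
        have h7 : 0 < i := by exact_mod_cast h5
        have h8 : i < 1 := by exact_mod_cast h6
        omega
      rw [P.l_eq_zero (by linarith) (by linarith), r, hce, hse, hr₀]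
      have := mul_pos (mul_pos hα (neg_pos.2 hs)) hgap
      linarith
    · have hk1 : (k : ℝ) ≤ -1 := by exact_mod_cast (by omega : k ≤ -1)
      obtain ⟨t, ht⟩ : ∃ t, t = Real.cos (2 * Real.pi * s) - Real.cos (2 * Real.pi * s₀) :=
        ⟨_, rfl⟩
      have ht1 : 2 / P.M ≤ t := by nlinarith only [ht, hcc, hk1, hM]
      have hl : P.l s ≤ 0 := by
        rcases le_total 0 (Real.sin (2 * Real.pi * s)) with h3 | h3
        · exact (P.l_eq_zero h3 (by linarith)).le
        · exact P.l_nonpos h3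
      have hlt : 0 < 8 * t +
          Real.sin (2 * Real.pi * s) * (P.n ^ 2 - Real.cos (2 * Real.pi * s) ^ 2) := by
        have h3 : |P.n ^ 2 - Real.cos (2 * Real.pi * s) ^ 2| ≤ 4 * t := by
          have h4 : P.n + Real.cos (2 * Real.pi * s) ≤ 2 * t := by
            nlinarith only [ht, ht1, hc, hY, hδ1, hM]
          have b1 := Real.cos_le_one (2 * Real.pi * s)
          have h5 : 0 ≤ P.n + Real.cos (2 * Real.pi * s) := by linarith
          rw [abs_le]
          constructor
          · nlinarith only [h1, sq_nonneg (Real.sin (2 * Real.pi * s)), hn, hn0, hn1, ht1, hδ, hM]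
          · nlinarith only [h4, h5, hn, b]
        have h4 := abs_le.1 ((abs_mul _ _).trans_le (mul_le_of_le_one_left (abs_nonneg
          (P.n ^ 2 - Real.cos (2 * Real.pi * s) ^ 2)) (Real.abs_sin_le_one (2 * Real.pi * s))))
        linarith [h4.1]
      have h5 := mul_pos hα hlt
      have h6 := mul_nonneg (neg_nonneg.2 hl) hv.le
      rw [r, hr₀]
      rw [ht] at h5
      linarith
  · change P.r s₀ < r₀
    rw [r, hr₀]
    have := mul_pos (mul_pos hα (neg_pos.2 hs)) hgap
    linarith
  · change deriv P.θ s₀ < 0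
    rw [P.deriv_θ]
    exact mul_neg_of_pos_of_neg (mul_pos hpi P.M_pos) hs

/-- The spiralling solid torus is contained in a slightly larger polydisc and ball. -/
lemma solid_bounds (hg : IsProfile g) (q : ℝ × ℂ) :
    Real.pi * ‖(P.steering.solid g q).1‖ ^ 2 < P.c + 9 * P.α + h / (1 - 3 * P.δ) ∧
    Real.pi * ‖(P.steering.solid g q).2‖ ^ 2 < 2 * h ∧
    Real.pi * (‖(P.steering.solid g q).1‖ ^ 2 + ‖(P.steering.solid g q).2‖ ^ 2) <
      P.c + 9 * P.α + 2 * h := by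
  have hδ : 0 < 1 - 3 * P.δ := by linarith [P.δ_le]
  obtain ⟨κ, hκ⟩ : ∃ κ, κ = 1 / (2 * (1 - 3 * P.δ)) := ⟨_, rfl⟩
  have hκ0 : 0 < κ := by rw [hκ]; positivity
  have hκ1 : κ < 1 := by
    rw [hκ, div_lt_one (by linarith)]
    linarith [P.δ_le]
  have hκh : κ * (2 * h) = h / (1 - 3 * P.δ) := by rw [hκ]; field_simp
  have h1 : Real.pi * ‖(P.steering.solid g q).1‖ ^ 2 = P.steering.radius q.1 (g q.2.re) :=
    pi_mul_norm_polar_sq (P.steering.radius_pos hg _ _).le _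
  have h2 : Real.pi * ‖(P.steering.solid g q).2‖ ^ 2 = h * (1 + g q.2.re) :=
    pi_mul_norm_polar_sq (P.steering.action_pos hg _).le _
  have h3 : P.steering.radius q.1 (g q.2.re) = P.r q.1 - P.l q.1 * (h * (1 - g q.2.re)) := rfl
  have hh := P.h_pos
  have hu := P.steering.action_pos hg q.2.re
  have hv : 0 < h * (1 - g q.2.re) := mul_pos hh (by linarith [hg.upper q.2.re])
  have hl := (abs_le.1 (P.abs_l_le q.1)).1
  have hr := (abs_le.1 (P.abs_r_sub_le q.1)).2
  rw [← hκ] at hl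
  have hlv : -(P.l q.1 * (h * (1 - g q.2.re))) ≤ κ * (h * (1 - g q.2.re)) := by
    nlinarith only [hl, hv]
  rw [← hκh, mul_add, h1, h2, h3]
  refine ⟨?_, by linarith, ?_⟩
  · nlinarith only [hlv, hr, hu, hκ0]
  · nlinarith only [hlv, hr, hv, hκ1]

end SpiralParams

/-- A neighbourhood of the closure contains a slightly larger intersection of ball and polydisc,
because shrinking the latter by a homothety moves it only a little into the former. -/
lemma exists_enlargement_subset {U : Set C2}
    (hU : U ∈ 𝓝ˢ (closure (ballCap 3 ∩ polydisc 2 2))) :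
    ∃ η : ℝ, 0 < η ∧ η ≤ 1 ∧ ∀ p : C2, Real.pi * ‖p.1‖ ^ 2 < 2 + η →
      Real.pi * ‖p.2‖ ^ 2 < 2 + η → Real.pi * (‖p.1‖ ^ 2 + ‖p.2‖ ^ 2) < 3 + η → p ∈ U := by
  have hpi := Real.pi_gt_three
  obtain ⟨V, hV, hKV, hVU⟩ := mem_nhdsSet_iff_exists.1 hU
  have hle : ∀ z : ℂ, Real.pi * ‖z‖ ^ 2 < 3 → ‖z‖ < 1 := fun z hz => by
    by_contra! h1
    nlinarith only [h1, hz, hpi]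
  have hbd : Bornology.IsBounded (ballCap 3 ∩ polydisc 2 2) := by
    refine (Metric.isBounded_closedBall (x := (0 : C2)) (r := 1)).subset fun p hp => ?_
    rw [mem_closedBall_zero_iff, Prod.norm_def]
    exact max_le (hle _ (by linarith [hp.2.1])).le (hle _ (by linarith [hp.2.2])).le
  obtain ⟨τ, hτ, hτV⟩ := hbd.isCompact_closure.exists_thickening_subset_open hV hKV
  refine ⟨min 1 τ, lt_min one_pos hτ, min_le_left _ _, fun p h1 h2 h3 => ?_⟩
  set η := min 1 τ with hη
  have hη0 : 0 < η := lt_min one_pos hτ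
  have hη1 : η ≤ 1 := min_le_left _ _
  refine hVU (hτV (Metric.mem_thickening_iff.2 ⟨(1 + η)⁻¹ • p, subset_closure ?_, ?_⟩))
  · have h4 : ∀ z : ℂ, ‖(1 + η)⁻¹ • z‖ ^ 2 * (1 + η) ^ 2 = ‖z‖ ^ 2 := fun z => by
      rw [norm_smul, Real.norm_of_nonneg (by positivity)]
      field_simp
    have h5 : 1 + 2 * η ≤ (1 + η) ^ 2 := by nlinarith only [sq_nonneg η]
    have h6 : 0 < (1 + η) ^ 2 := by positivity
    have h7 := h4 p.1
    have h8 := h4 p.2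
    refine ⟨?_, ?_, ?_⟩
    · change Real.pi * (‖(1 + η)⁻¹ • p.1‖ ^ 2 + ‖(1 + η)⁻¹ • p.2‖ ^ 2) < 3
      refine lt_of_mul_lt_mul_right ?_ h6.le
      rw [mul_assoc, add_mul, h7, h8]
      linarith
    · change Real.pi * ‖(1 + η)⁻¹ • p.1‖ ^ 2 < 2
      refine lt_of_mul_lt_mul_right ?_ h6.le
      rw [mul_assoc, h7]
      linarith
    · change Real.pi * ‖(1 + η)⁻¹ • p.2‖ ^ 2 < 2
      refine lt_of_mul_lt_mul_right ?_ h6.le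
      rw [mul_assoc, h8]
      linarith
  · have h4 : ‖p‖ < 1 := by
      rw [Prod.norm_def]
      exact max_lt (hle _ (by linarith)) (hle _ (by linarith))
    have h5 : p - (1 + η)⁻¹ • p = (η / (1 + η)) • p := by
      have h6 : η / (1 + η) = 1 - (1 + η)⁻¹ := by
        field_simp
        ring
      rw [h6, sub_smul, one_smul]
    have h6 : 0 ≤ η / (1 + η) := by positivity
    rw [dist_eq_norm, h5, norm_smul, Real.norm_of_nonneg h6]
    have h7 : η / (1 + η) ≤ η := div_le_self hη0.le (by linarith)
    have h8 : η ≤ τ := min_le_right _ _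
    rcases eq_or_lt_of_le h6 with h9 | h9
    · rw [← h9, zero_mul]
      exact hτ
    · nlinarith only [h4, h7, h8, h9]

/-- The basis `(1, 3)`, `(0, 1)` of the lattice `ℤ²`. -/
def latticeBasis : Module.Basis (Fin 2) ℤ (ℤ × ℤ) :=
  Module.Basis.ofEquivFun
    { toFun := fun e => ![e.1, e.2 - 3 * e.1]
      invFun := fun v => (v 0, v 1 + 3 * v 0)
      map_add' := fun e e' => by
        ext i
        fin_cases i
        · simp
        · simp
          ring
      map_smul' := fun c e => by
        ext i
        fin_cases i
        · simp
        · simp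
          ring
      left_inv := fun e => by simp
      right_inv := fun v => by
        ext i
        fin_cases i <;> simp }

lemma latticeBasis_zero : latticeBasis 0 = (1, 3) := by
  simp [latticeBasis, Module.Basis.coe_ofEquivFun]

lemma latticeBasis_one : latticeBasis 1 = (0, 1) := by
  simp [latticeBasis, Module.Basis.coe_ofEquivFun]

/-- The parameters of a spiral that sweeps out the prescribed area and stays close to the action
`1 + 4ε`: the more turns, the smaller the range of the action. -/
lemma exists_spiralParams {x h ε : ℝ} (hx : 2 < x) (hε : 0 < ε) (hε1 : ε ≤ 1 / 8) (hh : 1 ≤ h)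
    (hh1 : h < 1 + ε) : ∃ P : SpiralParams h, P.c = 1 + 4 * ε ∧ 9 * P.α ≤ ε ∧
      h / (1 - 3 * P.δ) < 1 + 2 * ε ∧ P.areaPrimitive 1 - P.areaPrimitive 0 = x - 3 := by
  have hpi := Real.pi_gt_three
  obtain ⟨M, hM⟩ : ∃ M, M = 16 + 18 * (x + 1) / ε := ⟨_, rfl⟩
  obtain ⟨n, hn⟩ : ∃ n, n = 1 - 2 * (1 - ε / 24) / M := ⟨_, rfl⟩
  have hx0 : 0 < 18 * (x + 1) / ε := by apply div_pos <;> linarith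
  have hM16 : 16 ≤ M := by linarith
  have hM0 : 0 < M := by linarith
  have hMε : 18 * (x + 1) ≤ ε * M := by
    have : ε * (18 * (x + 1) / ε) = 18 * (x + 1) := by field_simp
    rw [hM]
    linarith
  have hn78 : 7 / 8 ≤ n := by
    have : 2 * (1 - ε / 24) / M ≤ 1 / 8 := by
      rw [div_le_div_iff₀ hM0 (by norm_num)]
      linarith
    linarith
  have hN : 1 / 4 ≤ n ^ 2 / 2 - 1 / 8 := by nlinarith only [hn78]
  have hN0 : 0 < Real.pi * M * (n ^ 2 / 2 - 1 / 8) := by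
    have := Real.pi_pos
    have : 0 < n ^ 2 / 2 - 1 / 8 := by linarith
    positivity
  have hα : 9 * ((x - 3 + 2 * h) / (Real.pi * M * (n ^ 2 / 2 - 1 / 8))) ≤ ε := by
    rw [← mul_div_assoc, div_le_iff₀ hN0]
    have h1 : M / 2 ≤ Real.pi * M * (n ^ 2 / 2 - 1 / 8) := by
      have h2 : 3 * M ≤ Real.pi * M := mul_le_mul_of_nonneg_right hpi.le hM0.le
      nlinarith only [h2, hN, hM0]
    have h2 := mul_le_mul_of_nonneg_left h1 hε.le
    linarith
  have hδ : h / (1 - 3 * (ε / 24)) < 1 + 2 * ε := by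
    rw [div_lt_iff₀ (by linarith)]
    nlinarith only [hε, hε1, hh1]
  refine ⟨⟨M, ε / 24, (x - 3 + 2 * h) / (Real.pi * M * (n ^ 2 / 2 - 1 / 8)), 1 + 4 * ε,
    by linarith, hM16, by linarith, by linarith, div_pos (by linarith) hN0, by linarith⟩,
    rfl, hα, hδ, ?_⟩
  rw [SpiralParams.areaPrimitive_one_sub_zero, SpiralParams.n]
  simp only [← hn]
  rw [mul_right_comm, mul_div_cancel₀ _ hN0.ne']
  ring

end LagTorus

end

theorem mainTheorem5 (x : ℝ) (hx : 2 < x) (U : Set LagTorus.C2)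
    (hU : U ∈ 𝓝ˢ (closure (LagTorus.ballCap 3 ∩ LagTorus.polydisc 2 2))) :
    ∃ (L S : Set LagTorus.C2) (F : ℝ × ℝ → LagTorus.C2) (G : ℝ × ℂ → LagTorus.C2)
      (e : Module.Basis (Fin 2) ℤ (ℤ × ℤ)) (a b : ℂ),
      -- an embedded Lagrangian torus in `U`
      LagTorus.IsEmbeddedTorus F ∧ LagTorus.IsLagrangian F ∧ L = Set.range F ∧ L ⊆ U ∧
      -- an integral basis of its first homology, of Maslov index 2 and areas `x` and `1`
      LagTorus.MaslovClassEq F (e 0) 2 ∧ LagTorus.MaslovClassEq F (e 1) 2 ∧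
      LagTorus.AreaClassEq F (e 0) x ∧ LagTorus.AreaClassEq F (e 1) 1 ∧
      -- an embedded solid torus bounded by it
      LagTorus.IsEmbeddedSolidTorus G ∧ S = G '' LagTorus.solidCover ∧
      L = G '' {q : ℝ × ℂ | ‖q.2‖ = 1} ∧
      LagTorus.HasSymplecticMeridians G ∧ LagTorus.MeridianBoundaryClass G F (e 1) ∧
      LagTorus.HasClosedCharacteristicLeaves G ∧
      -- the position relative to two complex lines
      S ⊆ ({p : LagTorus.C2 | p.1 = a} ∪ {p : LagTorus.C2 | p.2 = b})ᶜ ∧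
      LagTorus.LinkingZEq F (e 1) a 0 ∧ LagTorus.LinkingWEq F (e 1) b 0 ∧
      LagTorus.LinkingZEq F (e 0) a 1 ∧ LagTorus.LinkingWEq F (e 0) b (-1) := by
  obtain ⟨η, hη, hη1, hηU⟩ := LagTorus.exists_enlargement_subset hU
  have hε : 0 < η / 8 := by linarith
  obtain ⟨g, h, B, hg, hh, hh1, hB, hB1⟩ := LagTorus.exists_profile hε
  obtain ⟨P, hc, hα, hδ, hA1⟩ := LagTorus.exists_spiralParams hx hε (by linarith) hh hh1
  obtain ⟨a, ha, harg⟩ := P.exists_line hg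
  have harea := fun e => P.steering.areaClassEq hg P.hasDerivAt_areaPrimitive hB e
  have hlinkZ : ∀ e, LagTorus.LinkingZEq (P.steering.torus g) e a e.1 := fun e γ hγ => by
    simpa using harg.hasWindingNumber hγ
  rw [hA1, hB1] at harea
  refine ⟨range (P.steering.torus g), P.steering.solid g '' LagTorus.solidCover,
    P.steering.torus g, P.steering.solid g, LagTorus.latticeBasis, a, 0,
    P.steering.isEmbeddedTorus hg, P.steering.isLagrangian hg, rfl, ?_, ?_⟩
  · rintro _ ⟨p, rfl⟩
    obtain ⟨h1, h2, h3⟩ := P.solid_bounds hg (LagTorus.Steering.boundaryCover p)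
    exact hηU (P.steering.solid g (LagTorus.Steering.boundaryCover p)) (by linarith)
      (by linarith) (by linarith)
  rw [LagTorus.latticeBasis_zero, LagTorus.latticeBasis_one]
  refine ⟨by simpa using P.steering.maslovClassEq hg (1, 3),
    by simpa using P.steering.maslovClassEq hg (0, 1), by simpa using harea (1, 3),
    by simpa using harea (0, 1), P.steering.isEmbeddedSolidTorus hg, rfl,
    P.steering.range_torus, P.steering.hasSymplecticMeridians hg,
    P.steering.meridianBoundaryClass, P.steering.hasClosedCharacteristicLeaves hg, ?_,
    hlinkZ (0, 1), by simpa using P.steering.linkingWEq hg (0, 1), hlinkZ (1, 3),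
    by simpa using P.steering.linkingWEq hg (1, 3)⟩
  rintro _ ⟨q, -, rfl⟩ (h1 | h1)
  · exact ha q h1
  · exact LagTorus.polar_ne_zero (P.steering.action_pos hg _) _ h1
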